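/- **Setting.** Let $N\ge 2$ and let $\mathcal N=\{1,\dots,N\}$ be the set of agents. Agent $i$ has actions $x_i\in\mathbb R^{n_i}$ and cost $J_i:\mathbb R^n\to\mathbb R$, $n=\sum_i n_i$. For every $i$ and every fixed $x_{-i}$, the map $x_i\mapsto J_i(x_i,x_{-i})$ is $C^1$, convex and radially unbounded. The pseudo-gradient $F(x)=\mathrm{col}(\partial J_i(x)/\partial x_i)_{i\in\mathcal N}$ is $\mu$-strongly monotone ($\mu>0$) and $L$-Lipschitz in the Euclidean norm. A Nash equilibrium is a profile $x^*$ such that, for every $i$, $x_i^*$ minimizes $J_i(\cdot,x_{-i}^*)$ over $\mathbb R^{n_i}$. Let $\mathcal G_c$ (communication) and $\mathcal G_o$ (observation) be directed graphs on $\mathcal N$, where every agent observes itself in $\mathcal G_o$. An edge from $j$ to $i$ makes $j$ an in-neighbour of $i$ and $i$ an out-neighbour of $j$. Let $\mathcal N=\mathcal T\sqcup\mathcal A$ (truthful and adversarial agents), and let $D\ge 0$ be an integer. Assume: * every $i\in\mathcal T$ has at most $D$ in-neighbours in $\mathcal A$ and at least $2D+1$ in-neighbours, all with respect to $\mathcal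 G_c$; * every node $m$ is $(2D+1)$-information robust: for each proper subset $S\subsetneq\mathcal N$ that contains all out-neighbours of $m$ in $\mathcal G_o$, there is $j\notin S$ with at least $2D+1$ in-neighbours in $\mathcal G_c$ that lie in $S$. **Algorithm 1** with step size $\alpha$ and weight bound $\eta\in(0,1]$. At iteration $k$ agent $i$ holds an estimate $\mathbf x^i[k]\in\mathbb R^n$ of the whole profile (its $i$-th block is its own action), and $j$ sends $i$ a message $\mathbf y^{ij}[k]\in\mathbb R^n$. Truthful agents $j$ send $\mathbf y^{ij}[k]=\mathbf x^j[k]$, messages of adversarial agents are arbitrary, and $\mathbf y^{ii}[k]=\mathbf x^i[k]$. For every scalar component $(m,q)$, an intermediate estimate $\mathbf v^i_{mq}[k]$ is formed: * if $i$ observes $m$ in $\mathcal G_o$, then $\mathbf v^i_{mq}[k]=\mathbf x^m_{mq}[k]$, the true action component; * if $i\in\mathcal T$ does not observe $m$, then among the messages $\mathbf y^{ij}_{mq}[k]$ from its in-neighbours $j$ in $\mathcal G_c$ it removes the $D$ largest of those larger than $\mathbf x^i_{mq}[k]$ and the $D$ smallest of those smaller than $\mathbf x^i_{mq}[k]$ (all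 of them if there are fewer than $D$; ties broken arbitrarily). It sets $\mathbf v^i_{mq}[k]=\sum_{j\in\mathcal Y}w_j\mathbf y^{ij}_{mq}[k]$, where $\mathcal Y$ consists of the retained senders and $i$ itself, $\sum_{j\in\mathcal Y}w_j=1$ and every $w_j\ge\eta$. The weights may depend on $i,m,q,k$; * if $i\in\mathcal A$ does not observe $m$, then $\mathbf v^i_{mq}[k]$ is some convex combination of the messages $\mathbf y^{ij}_{mq}[k]$ of its truthful in-neighbours $j$ in $\mathcal G_c$ and of its own estimate $\mathbf x^i_{mq}[k]$, in which the truthful messages have total weight at least $\eta$. Then every agent sets $\mathbf x^i[k+1]=\mathbf v^i[k]-\alpha\,\mathcal R_i^T\,\partial J_i(\mathbf v^i[k])/\partial x_i$, where $\mathcal R_i^T$ embeds $\mathbb R^{n_i}$ into $\mathbb R^n$ as the $i$-th block. The initial $\mathbf x[0]$ and $\mathbf v[0]$ are arbitrary ($\mathbf v[0]$ may, but need not, be formed from $\mathbf x[0]$ as above), and the rules for $\mathbf v[k]$ are imposed for $k\ge1$. **Theorem.** Let $C=1-(\eta/2)^{N-1}$, $\ \overline p=\dfrac{4N}{1-C^{2/(N-1)}}$,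 and $$M=\begin{bmatrix}2\alpha\mu-\overline p\alpha^2L^2&-\alpha\overline pL(1+\alpha L)\\-\alpha\overline pL(1+\alpha L)&1-2\alpha(\overline p-1)L-\overline p\alpha^2L^2\end{bmatrix}.$$ If $M$ is positive definite, then the game has exactly one Nash equilibrium $x^*$, and every execution of Algorithm 1, from any initial condition, satisfies $\mathbf x^i[k]\to x^*$ for all $i\in\mathcal N$ as $k\to\infty$, i.e. $\mathrm{col}(\mathbf x^i[k])_{i\in\mathcal N}\to\mathbf 1\otimes x^*$. -/

import Mathlib

namespace RobustNE

noncomputable section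

/-! ### Games -/

/-- Action space `ℝ^{n_i}` of player `i`, with its Euclidean norm. -/
abbrev Action {N : ℕ} (d : Fin N → ℕ) (i : Fin N) : Type :=
  EuclideanSpace ℝ (Fin (d i))

/-- Action profiles: `ℝ^n` with `n = ∑ n_i`; the coordinate `⟨m, q⟩` is the `q`-th component of
the action of player `m`. Euclidean norm. -/
abbrev Profile {N : ℕ} (d : Fin N → ℕ) : Type :=
  EuclideanSpace ℝ ((m : Fin N) × Fin (d m))

/-- The block `x_i` of a profile. -/
def block {N : ℕ} {d : Fin N → ℕ} (x : Profile d) (i : Fin N) : Action d i :=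
  WithLp.toLp 2 (fun q => x ⟨i, q⟩)

/-- The profile `(t, x_{-i})`: the block of player `i` is replaced by `t`. -/
def setBlock {N : ℕ} {d : Fin N → ℕ} (x : Profile d) (i : Fin N) (t : Action d i) : Profile d :=
  WithLp.toLp 2 (fun p => if h : p.1 = i then t (Fin.cast (congrArg d h) p.2) else x p)

/-- The partial gradient `∂J_i/∂x_i` at `x`. -/
def partialGrad {N : ℕ} {d : Fin N → ℕ} (J : Fin N → Profile d → ℝ) (i : Fin N)
    (x : Profile d) : Action d i :=
  gradient (fun t : Action d i => J i (setBlock x i t)) (block x i)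

/-- The pseudo-gradient `F(x) = col (∂J_i(x)/∂x_i)_i`. -/
def pseudoGrad {N : ℕ} {d : Fin N → ℕ} (J : Fin N → Profile d → ℝ) (x : Profile d) :
    Profile d :=
  WithLp.toLp 2 (fun p => partialGrad J p.1 x p.2)

/-- Nash equilibrium of the unconstrained game. -/
def IsNash {N : ℕ} {d : Fin N → ℕ} (J : Fin N → Profile d → ℝ) (x : Profile d) : Prop :=
  ∀ (i : Fin N) (t : Action d i), J i x ≤ J i (setBlock x i t)

/-- Standing assumption on the game: for every fixed `x_{-i}` the cost `J_i(·, x_{-i})` is `C^1`,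
convex and radially unbounded, and the pseudo-gradient is `μ`-strongly monotone and
`L`-Lipschitz. -/
structure RegularGame {N : ℕ} {d : Fin N → ℕ} (J : Fin N → Profile d → ℝ) (μ : ℝ)
    (L : NNReal) : Prop where
  contDiff : ∀ (i : Fin N) (x : Profile d),
    ContDiff ℝ 1 (fun t : Action d i => J i (setBlock x i t))
  convex : ∀ (i : Fin N) (x : Profile d),
    ConvexOn ℝ Set.univ (fun t : Action d i => J i (setBlock x i t))
  radiallyUnbounded : ∀ (i : Fin N) (x : Profile d),
    Filter.Tendsto (fun t : Action d i => J i (setBlock x i t))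
      (Filter.cocompact (Action d i)) Filter.atTop
  mu_pos : 0 < μ
  stronglyMonotone : ∀ x y : Profile d,
    μ * ‖x - y‖ ^ 2 ≤ inner ℝ (x - y) (pseudoGrad J x - pseudoGrad J y)
  lipschitz : LipschitzWith L (pseudoGrad J)

/-! ### Graphs. `G.Adj j i` is the edge from `j` to `i` (information flows from `j` to `i`). -/

open Classical in
/-- In-neighbours of `i`. -/
def inNbrs {N : ℕ} (G : Digraph (Fin N)) (i : Fin N) : Finset (Fin N) :=
  Finset.univ.filter (fun j => G.Adj j i)

open Classical in
/-- Out-neighbours of `i`. -/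
def outNbrs {N : ℕ} (G : Digraph (Fin N)) (i : Fin N) : Finset (Fin N) :=
  Finset.univ.filter (fun j => G.Adj i j)

/-- `S` is `r`-local in `G`: every node outside `S` has at most `r` in-neighbours in `S`. -/
def IsLocalSet {N : ℕ} (G : Digraph (Fin N)) (r : ℕ) (S : Finset (Fin N)) : Prop :=
  ∀ i ∉ S, (inNbrs G i ∩ S).card ≤ r

/-- Node `i` is `r`-information robust: every proper set `S` of nodes that contains all nodes
observing `i` leaves out a node with at least `r` communication in-neighbours in `S`. -/
def InfoRobust {N : ℕ} (Gc Go : Digraph (Fin N)) (r : ℕ) (i : Fin N) : Prop :=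
  ∀ S : Finset (Fin N), outNbrs Go i ⊆ S → S ≠ Finset.univ →
    ∃ j ∉ S, r ≤ (inNbrs Gc j ∩ S).card

/-! ### The algorithm -/

/-- `R` consists of the `D` largest values (of all, if there are fewer than `D`) among the
senders in `nbrs` whose value `val j` exceeds `own`; ties are broken arbitrarily. -/
def RemovesHighest {N : ℕ} (D : ℕ) (nbrs : Finset (Fin N)) (own : ℝ) (val : Fin N → ℝ)
    (R : Finset (Fin N)) : Prop :=
  R ⊆ nbrs ∧ (∀ j ∈ R, own < val j) ∧
    R.card = min D (nbrs.filter (fun j => own < val j)).card ∧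
    ∀ a ∈ R, ∀ b ∈ nbrs, b ∉ R → val b ≤ val a

/-- `R` consists of the `D` smallest values (of all, if there are fewer than `D`) among the
senders in `nbrs` whose value `val j` is below `own`; ties are broken arbitrarily. -/
def RemovesLowest {N : ℕ} (D : ℕ) (nbrs : Finset (Fin N)) (own : ℝ) (val : Fin N → ℝ)
    (R : Finset (Fin N)) : Prop :=
  R ⊆ nbrs ∧ (∀ j ∈ R, val j < own) ∧
    R.card = min D (nbrs.filter (fun j => val j < own)).card ∧
    ∀ a ∈ R, ∀ b ∈ nbrs, b ∉ R → val a ≤ val b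

/-- `Y` is a possible outcome of the trimming done by agent `i`: the agents whose message is
retained, together with `i` itself. -/
def IsRetained {N : ℕ} (D : ℕ) (nbrs : Finset (Fin N)) (i : Fin N) (own : ℝ) (val : Fin N → ℝ)
    (Y : Finset (Fin N)) : Prop :=
  ∃ RH RL : Finset (Fin N), RemovesHighest D nbrs own val RH ∧ RemovesLowest D nbrs own val RL ∧
    Y = insert i (nbrs \ (RH ∪ RL))

/-- Value that a truthful agent `i` may compute from the messages `val j` about one scalar
component that it does not observe: trim, then average the retained messages with weights that
sum to one and are at least `η`. -/
def TruthfulAverage {N : ℕ} (Gc : Digraph (Fin N)) (D : ℕ) (η : ℝ) (i : Fin N) (own : ℝ)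
    (val : Fin N → ℝ) (out : ℝ) : Prop :=
  ∃ (Y : Finset (Fin N)) (w : Fin N → ℝ), IsRetained D (inNbrs Gc i) i own val Y ∧
    (∀ j ∈ Y, η ≤ w j) ∧ ∑ j ∈ Y, w j = 1 ∧ out = ∑ j ∈ Y, w j * val j

/-- Value that an adversarial agent `i ∈ A` may compute from the messages `val j` about one scalar
component that it does not observe: a weighted average of the messages of its truthful
in-neighbours, in which its own estimate `val i` may also take part as long as the truthful
messages keep total weight at least `η`. -/
def AdversaryAverage {N : ℕ} (Gc : Digraph (Fin N)) (A : Finset (Fin N)) (η : ℝ) (i : Fin N)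
    (val : Fin N → ℝ) (out : ℝ) : Prop :=
  ∃ w : Fin N → ℝ, (∀ j, 0 ≤ w j) ∧ (∀ j, j ∉ inNbrs Gc i \ A → j ≠ i → w j = 0) ∧
    ∑ j, w j = 1 ∧ η ≤ ∑ j ∈ inNbrs Gc i \ A, w j ∧ out = ∑ j, w j * val j

/-- `x`, `v`, `y` form an execution of the algorithm with adversary set `A`.
`x k i` is the estimate of the whole profile held by agent `i` at iteration `k` (its `i`-th block
is the action that `i` plays), `v k i` the intermediate estimate, and `y k i j` the message that
agent `j` sends to agent `i`. Nothing is required of the messages sent by adversaries. The pair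
`x 0`, `v 0` is an arbitrary initial condition; in particular `v 0` may, but need not, be computed
from `x 0` by the averaging step. -/
structure IsExecution {N : ℕ} {d : Fin N → ℕ} (J : Fin N → Profile d → ℝ)
    (Gc Go : Digraph (Fin N)) (A : Finset (Fin N)) (D : ℕ) (η α : ℝ)
    (x v : ℕ → Fin N → Profile d) (y : ℕ → Fin N → Fin N → Profile d) : Prop where
  self_message : ∀ k i, y k i i = x k i
  truthful_message : ∀ k, ∀ j ∉ A, ∀ i, Gc.Adj j i → y k i j = x k j
  observed : ∀ k, k ≠ 0 → ∀ (i m : Fin N) (q : Fin (d m)), Go.Adj m i →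
    v k i ⟨m, q⟩ = x k m ⟨m, q⟩
  truthful_average : ∀ k, k ≠ 0 → ∀ i ∉ A, ∀ (m : Fin N) (q : Fin (d m)), ¬ Go.Adj m i →
    TruthfulAverage Gc D η i (x k i ⟨m, q⟩) (fun j => y k i j ⟨m, q⟩) (v k i ⟨m, q⟩)
  adversary_average : ∀ k, k ≠ 0 → ∀ i ∈ A, ∀ (m : Fin N) (q : Fin (d m)), ¬ Go.Adj m i →
    AdversaryAverage Gc A η i (fun j => y k i j ⟨m, q⟩) (v k i ⟨m, q⟩)
  gradient_step : ∀ k i,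
    x (k + 1) i = v k i - α • setBlock 0 i (partialGrad J i (v k i))

/-! ### The step-size condition -/

/-- `C = 1 - (η/2)^{N-1}`. -/
def contractionC (N : ℕ) (η : ℝ) : ℝ := 1 - (η / 2) ^ (N - 1)

/-- `p̄ = 4N / (1 - C^{2/(N-1)})`, meaningful for `N ≥ 2`. -/
def pBar (N : ℕ) (η : ℝ) : ℝ :=
  4 * (N : ℝ) / (1 - Real.rpow (contractionC N η) (2 / ((N : ℝ) - 1)))

/-- The matrix `M` built from `μ`, `L`, `p̄` and the step size `α`. -/
def matM (μ L p α : ℝ) : Matrix (Fin 2) (Fin 2) ℝ :=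
  !![2 * α * μ - p * α ^ 2 * L ^ 2, -(α * p * L * (1 + α * L));
     -(α * p * L * (1 + α * L)), 1 - 2 * α * (p - 1) * L - p * α ^ 2 * L ^ 2]

end

end RobustNE

/-! Fix one scalar component `⟨m, q⟩`. An adversarial message that survives trimming lies between
estimates of truthful in-neighbours and the agent's own estimate, so each trimmed average is also a
convex combination of genuine estimates, with weight at least `η` on any set containing `D + 1`
truthful in-neighbours (`TruthfulAverage.exists_weights`). Information robustness layers the agents
into levels `0, ..., N - 1`, with `m` alone at level `0`, so that every agent not observing `m` puts
weight at least `η` on lower levels (`exists_level`, `IsExecution.exists_weights`). The levels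
depend only on the graphs, on `A`, `D` and on `m`, not on time or state.

Hence the estimation error obeys `e (k+1) = B (k+1) (e k + α g 1)`, where `g` is the component of
the gradient used. The matrices `B` are state-dependent and otherwise unknown, but all are
substochastic for the same levels; any `N - 1` of them in succession shrink the maximum norm by the
factor `C` (`abs_traj_le_contraction`). The quadratic function `energy`, the sum of squares along
the future unperturbed trajectory, therefore converges. Without perturbation it drops by exactly
`‖e‖²` per step; the drift `α g` costs a multiple `p̄ - 1` of `2 |α g| ‖e‖ + (α g)²`
(`SquareDecay.energy_step_le`).

Equilibria are the zeros of the pseudo-gradient; strong monotonicity gives uniqueness, and the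
contraction `x ↦ x - α F(x)` gives existence. Adding the squared distance of the played profile to
the equilibrium to the energies yields a Lyapunov function that drops at least by the quadratic form
of `M` in the two distances, to equilibrium and to agreement (`IsExecution.lyapunov_step`). Positive
definiteness makes the squared distances summable, so both tend to zero. -/

namespace RobustNE

/-! ### Trimmed averages as averages of truthful values -/

/-- A value between two values `val l` and `val h` is a weighted average of these. -/
lemma exists_weights_of_between {ι : Type*} [Fintype ι] [DecidableEq ι] (val : ι → ℝ) {l h : ι}
    {x : ℝ} (hl : val l ≤ x) (hh : x ≤ val h) :
    ∃ b : ι → ℝ, (∀ j, 0 ≤ b j) ∧ (∀ j, j ≠ l → j ≠ h → b j = 0) ∧ ∑ j, b j = 1 ∧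
      x = ∑ j, b j * val j := by
  obtain ⟨s, t, hs, ht, hst, hx⟩ : x ∈ segment ℝ (val l) (val h) := by
    rw [segment_eq_Icc (hl.trans hh)]; exact ⟨hl, hh⟩
  refine ⟨s • Pi.single l 1 + t • Pi.single h 1, fun j => ?_, fun j h1 h2 => ?_, ?_, ?_⟩
  · have h1 : (0 : ℝ) ≤ (Pi.single l (1 : ℝ) : ι → ℝ) j := by
      by_cases hj : j = l
      · subst hj; simp
      · simp [hj]
    have h2 : (0 : ℝ) ≤ (Pi.single h (1 : ℝ) : ι → ℝ) j := by
      by_cases hj : j = h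
      · subst hj; simp
      · simp [hj]
    simp only [Pi.add_apply, Pi.smul_apply, smul_eq_mul]
    positivity
  · simp [h1, h2]
  · simp [Finset.sum_add_distrib, ← Finset.mul_sum, hst]
  · rw [← hx]
    simp [add_mul, Finset.sum_add_distrib, Pi.single_apply, smul_eq_mul]

section Trim

variable {N : ℕ} {D : ℕ} {nbrs A S : Finset (Fin N)} {i : Fin N} {own : ℝ} {val : Fin N → ℝ}

lemma RemovesHighest.card_le {R : Finset (Fin N)} (h : RemovesHighest D nbrs own val R) :
    R.card ≤ D := h.2.2.1 ▸ min_le_left _ _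

lemma RemovesLowest.card_le {R : Finset (Fin N)} (h : RemovesLowest D nbrs own val R) :
    R.card ≤ D := h.2.2.1 ▸ min_le_left _ _

/-- A retained sender with a value above `own` is dominated by a removed truthful sender. -/
lemma RemovesHighest.exists_truthful_ge {R : Finset (Fin N)} (h : RemovesHighest D nbrs own val R)
    (hA : (nbrs ∩ A).card ≤ D) {j : Fin N} (hj : j ∈ nbrs) (hjA : j ∈ A) (hjR : j ∉ R)
    (hv : own < val j) : ∃ t ∈ nbrs \ A, val j ≤ val t := by
  obtain ⟨h1, h2, h3, h4⟩ := h
  have hlt : R.card < (nbrs.filter (fun j => own < val j)).card := by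
    refine Finset.card_lt_card ((Finset.ssubset_iff_of_subset ?_).2 ⟨j, ?_, hjR⟩)
    · exact fun a ha => Finset.mem_filter.2 ⟨h1 ha, h2 a ha⟩
    · exact Finset.mem_filter.2 ⟨hj, hv⟩
  -- A value above `own` survived, so the quota `D` was exhausted. If all removed senders were
  -- adversarial, then together with `j` there would be `D + 1` adversarial in-neighbours.
  have hD : R.card = D := by omega
  have hnot : ¬ R ⊆ A := by
    intro hsub
    have : insert j R ⊆ nbrs ∩ A := by
      intro a ha
      rcases Finset.mem_insert.1 ha with rfl | ha
      · exact Finset.mem_inter.2 ⟨hj, hjA⟩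
      · exact Finset.mem_inter.2 ⟨h1 ha, hsub ha⟩
    have := Finset.card_le_card this
    rw [Finset.card_insert_of_notMem hjR] at this
    omega
  obtain ⟨t, ht, htA⟩ := Finset.not_subset.1 hnot
  exact ⟨t, Finset.mem_sdiff.2 ⟨h1 ht, htA⟩, h4 t ht j hj hjR⟩

lemma RemovesLowest.neg {R : Finset (Fin N)} (h : RemovesLowest D nbrs own val R) :
    RemovesHighest D nbrs (-own) (fun j => -val j) R := by
  obtain ⟨h1, h2, h3, h4⟩ := h
  refine ⟨h1, fun j hj => neg_lt_neg (h2 j hj), ?_,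
    fun a ha b hb hbR => neg_le_neg (h4 a ha b hb hbR)⟩
  simpa only [neg_lt_neg_iff] using h3

lemma RemovesLowest.exists_truthful_le {R : Finset (Fin N)} (h : RemovesLowest D nbrs own val R)
    (hA : (nbrs ∩ A).card ≤ D) {j : Fin N} (hj : j ∈ nbrs) (hjA : j ∈ A) (hjR : j ∉ R)
    (hv : val j < own) : ∃ t ∈ nbrs \ A, val t ≤ val j := by
  obtain ⟨t, ht, hle⟩ := h.neg.exists_truthful_ge hA hj hjA hjR (neg_lt_neg hv)
  exact ⟨t, ht, neg_le_neg_iff.1 hle⟩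

/-- After trimming, every retained value is an average of the values of truthful in-neighbours and
of `i`, and one of them is even an average of values of truthful in-neighbours in `S`, provided that
there are at least `D + 1` of these. -/
lemma IsRetained.exists_weights {Y : Finset (Fin N)} (hY : IsRetained D nbrs i own val Y)
    (hown : val i = own) (hA : (nbrs ∩ A).card ≤ D)
    (hS : D + 1 ≤ ((nbrs \ A) ∩ S).card) :
    ∃ (b : Fin N → Fin N → ℝ) (j₀ : Fin N), j₀ ∈ Y ∧ ∑ l ∈ S, b j₀ l = 1 ∧
      ∀ j ∈ Y, (∀ l, 0 ≤ b j l) ∧ (∀ l, l ∉ nbrs \ A → l ≠ i → b j l = 0) ∧ ∑ l, b j l = 1 ∧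
        val j = ∑ l, b j l * val l := by
  obtain ⟨RH, RL, hH, hL, rfl⟩ := hY
  have key : ∀ j ∈ insert i (nbrs \ (RH ∪ RL)), ∃ b : Fin N → ℝ, (∀ l, 0 ≤ b l) ∧
      (∀ l, l ∉ nbrs \ A → l ≠ i → b l = 0) ∧ ∑ l, b l = 1 ∧ val j = ∑ l, b l * val l := by
    intro j hj
    have aux : ∀ l h : Fin N, (l ∈ nbrs \ A ∨ l = i) → (h ∈ nbrs \ A ∨ h = i) →
        val l ≤ val j → val j ≤ val h → ∃ b : Fin N → ℝ, (∀ l, 0 ≤ b l) ∧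
      (∀ l, l ∉ nbrs \ A → l ≠ i → b l = 0) ∧ ∑ l, b l = 1 ∧ val j = ∑ l, b l * val l := by
      intro l h hl hh h1 h2
      obtain ⟨b, hb0, hb1, hb2, hb3⟩ := exists_weights_of_between val h1 h2
      refine ⟨b, hb0, fun t ht hti => hb1 t ?_ ?_, hb2, hb3⟩
      · rintro rfl; tauto
      · rintro rfl; tauto
    rcases Finset.mem_insert.1 hj with rfl | hj
    · exact aux j j (Or.inr rfl) (Or.inr rfl) le_rfl le_rfl
    simp only [Finset.mem_sdiff, Finset.mem_union, not_or] at hj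
    obtain ⟨hjn, hjH, hjL⟩ := hj
    by_cases hjA : j ∈ A
    · rcases lt_trichotomy (val j) own with hlt | heq | hgt
      · obtain ⟨t, ht, hle⟩ := hL.exists_truthful_le hA hjn hjA hjL hlt
        exact aux t i (Or.inl ht) (Or.inr rfl) hle (hown ▸ hlt.le)
      · exact aux i i (Or.inr rfl) (Or.inr rfl) (by rw [hown, heq]) (by rw [hown, heq])
      · obtain ⟨t, ht, hle⟩ := hH.exists_truthful_ge hA hjn hjA hjH hgt
        exact aux i t (Or.inr rfl) (Or.inl ht) (hown ▸ hgt.le) hle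
    · have : j ∈ nbrs \ A := Finset.mem_sdiff.2 ⟨hjn, hjA⟩
      exact aux j j (Or.inl this) (Or.inl this) le_rfl le_rfl
  have key0 : ∃ j₀ ∈ insert i (nbrs \ (RH ∪ RL)), ∃ b : Fin N → ℝ, (∀ l, 0 ≤ b l) ∧
      (∀ l, l ∉ (nbrs \ A) ∩ S → b l = 0) ∧ ∑ l, b l = 1 ∧ val j₀ = ∑ l, b l * val l := by
    have aux : ∀ j l h : Fin N, l ∈ (nbrs \ A) ∩ S → h ∈ (nbrs \ A) ∩ S →
        val l ≤ val j → val j ≤ val h → ∃ b : Fin N → ℝ, (∀ l, 0 ≤ b l) ∧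
      (∀ l, l ∉ (nbrs \ A) ∩ S → b l = 0) ∧ ∑ l, b l = 1 ∧ val j = ∑ l, b l * val l := by
      intro j l h hl hh h1 h2
      obtain ⟨b, hb0, hb1, hb2, hb3⟩ := exists_weights_of_between val h1 h2
      refine ⟨b, hb0, fun t ht => hb1 t ?_ ?_, hb2, hb3⟩
      · rintro rfl; exact ht hl
      · rintro rfl; exact ht hh
    -- Either some truthful in-neighbour in `S` is retained and serves as `j₀`, or all are removed.
    -- In the latter case more than `D` of them cannot all be on one side, so values from `S` lie
    -- both above and below `own`, and `j₀ = i` works.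
    by_cases hex : (nbrs \ A) ∩ S ⊆ RH ∪ RL
    · have hnL : ¬ (nbrs \ A) ∩ S ⊆ RL := fun h => by
        have := Finset.card_le_card h; have := hL.card_le; omega
      have hnH : ¬ (nbrs \ A) ∩ S ⊆ RH := fun h => by
        have := Finset.card_le_card h; have := hH.card_le; omega
      obtain ⟨h, hhS, hhL⟩ := Finset.not_subset.1 hnL
      obtain ⟨l, hlS, hlH⟩ := Finset.not_subset.1 hnH
      have hh : h ∈ RH := (Finset.mem_union.1 (hex hhS)).resolve_right hhL
      have hl : l ∈ RL := (Finset.mem_union.1 (hex hlS)).resolve_left hlH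
      exact ⟨i, Finset.mem_insert_self _ _, aux i l h hlS hhS (hown ▸ (hL.2.1 l hl).le)
        (hown ▸ (hH.2.1 h hh).le)⟩
    · obtain ⟨s, hs, hsR⟩ := Finset.not_subset.1 hex
      refine ⟨s, Finset.mem_insert_of_mem (Finset.mem_sdiff.2 ⟨?_, hsR⟩),
        aux s s s hs hs le_rfl le_rfl⟩
      exact (Finset.mem_sdiff.1 (Finset.mem_inter.1 hs).1).1
  obtain ⟨j₀, hj₀, b₀, h0, h1, h2, h3⟩ := key0
  choose! b hb using key
  refine ⟨Function.update b j₀ b₀, j₀, hj₀, ?_, fun j hj => ?_⟩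
  · rw [Function.update_self, ← h2]
    refine Finset.sum_subset (Finset.subset_univ _) fun l _ hl => h1 l fun hl' => ?_
    exact hl (Finset.mem_inter.1 hl').2
  · by_cases hjj : j = j₀
    · subst hjj
      rw [Function.update_self]
      exact ⟨h0, fun l hl _ => h1 l fun hl' => hl (Finset.mem_inter.1 hl').1, h2, h3⟩
    · rw [Function.update_of_ne hjj]
      exact hb j hj

end Trim

/-- The outcome of a truthful averaging step is an average of the values of the truthful
in-neighbours and of the agent itself, with weight at least `η` on any set that contains at least
`D + 1` truthful in-neighbours. -/
lemma TruthfulAverage.exists_weights {N : ℕ} {Gc : Digraph (Fin N)} {D : ℕ} {η : ℝ} {i : Fin N}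
    {own : ℝ} {val : Fin N → ℝ} {out : ℝ} (h : TruthfulAverage Gc D η i own val out)
    (hη : 0 ≤ η) (hown : val i = own) {A S : Finset (Fin N)} (hA : (inNbrs Gc i ∩ A).card ≤ D)
    (hS : D + 1 ≤ ((inNbrs Gc i \ A) ∩ S).card) :
    ∃ a : Fin N → ℝ, (∀ l, 0 ≤ a l) ∧ (∀ l, l ∉ inNbrs Gc i \ A → l ≠ i → a l = 0) ∧
      ∑ l, a l = 1 ∧ η ≤ ∑ l ∈ S, a l ∧ out = ∑ l, a l * val l := by
  obtain ⟨Y, w, hY, hw, hw1, rfl⟩ := h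
  obtain ⟨b, j₀, hj₀, hb₀, hb⟩ := hY.exists_weights hown hA hS
  have hw0 : ∀ j ∈ Y, 0 ≤ w j := fun j hj => hη.trans (hw j hj)
  refine ⟨fun l => ∑ j ∈ Y, w j * b j l, fun l => ?_, fun l hl hli => ?_, ?_, ?_, ?_⟩
  · exact Finset.sum_nonneg fun j hj => mul_nonneg (hw0 j hj) ((hb j hj).1 l)
  · exact Finset.sum_eq_zero fun j hj => by rw [(hb j hj).2.1 l hl hli, mul_zero]
  · rw [Finset.sum_comm, ← hw1]
    exact Finset.sum_congr rfl fun j hj => by rw [← Finset.mul_sum, (hb j hj).2.2.1, mul_one]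
  · rw [Finset.sum_comm]
    calc η ≤ w j₀ := hw j₀ hj₀
      _ = ∑ l ∈ S, w j₀ * b j₀ l := by rw [← Finset.mul_sum, hb₀, mul_one]
      _ ≤ _ := Finset.single_le_sum (f := fun j => ∑ l ∈ S, w j * b j l) (fun j hj =>
        Finset.sum_nonneg fun l _ => mul_nonneg (hw0 j hj) ((hb j hj).1 l)) hj₀
  · simp only [Finset.sum_mul]
    rw [Finset.sum_comm]
    refine Finset.sum_congr rfl fun j hj => ?_
    conv_lhs => rw [(hb j hj).2.2.2, Finset.mul_sum]
    exact Finset.sum_congr rfl fun l _ => by ring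

/-! ### Levels: how information about one agent spreads -/

open Classical in
/-- The agents reached after `t` rounds by information about `m`, among the truthful agents, when
an agent that does not observe `m` needs `D + 1` truthful in-neighbours that have been reached. -/
noncomputable def reached {N : ℕ} (Gc Go : Digraph (Fin N)) (A : Finset (Fin N)) (D : ℕ)
    (m : Fin N) : ℕ → Finset (Fin N)
  | 0 => {m}
  | t + 1 => reached Gc Go A D m t ∪ outNbrs Go m ∪
      Finset.univ.filter (fun j => j ∉ A ∧ D + 1 ≤ ((inNbrs Gc j \ A) ∩ reached Gc Go A D m t).card)

section Levels

variable {N : ℕ} {Gc Go : Digraph (Fin N)} {A : Finset (Fin N)} {D : ℕ} {m : Fin N}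

lemma mem_outNbrs {G : Digraph (Fin N)} {i j : Fin N} : j ∈ outNbrs G i ↔ G.Adj i j := by
  simp [outNbrs]

lemma mem_inNbrs {G : Digraph (Fin N)} {i j : Fin N} : j ∈ inNbrs G i ↔ G.Adj j i := by
  simp [inNbrs]

lemma reached_subset_succ (t : ℕ) : reached Gc Go A D m t ⊆ reached Gc Go A D m (t + 1) := by
  rw [reached]
  exact Finset.subset_union_left.trans Finset.subset_union_left

lemma mem_reached_self (t : ℕ) : m ∈ reached Gc Go A D m t := by
  induction t with
  | zero => simp [reached]
  | succ t ih => exact reached_subset_succ t ih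

/-- As long as some truthful agent has not been reached, each round reaches a further one. -/
lemma exists_reached_succ (hlocal : IsLocalSet Gc D A) (hrobust : InfoRobust Gc Go (2 * D + 1) m)
    {t : ℕ} (ht : reached Gc Go A D m t ∪ A ≠ Finset.univ) :
    ∃ j ∉ reached Gc Go A D m t ∪ A, j ∈ reached Gc Go A D m (t + 1) := by
  by_cases hO : outNbrs Go m ⊆ reached Gc Go A D m t ∪ A
  · obtain ⟨j, hj, hcard⟩ := hrobust _ hO ht
    refine ⟨j, hj, ?_⟩
    have hjA : j ∉ A := fun h => hj (Finset.mem_union_right _ h)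
    rw [reached]
    refine Finset.mem_union_right _ (Finset.mem_filter.2 ⟨Finset.mem_univ _, hjA, ?_⟩)
    -- Of the `2 * D + 1` in-neighbours at most `D` are adversarial, which leaves `D + 1` truthful
    -- ones already reached.
    have hsub : inNbrs Gc j ∩ (reached Gc Go A D m t ∪ A) ⊆
        ((inNbrs Gc j \ A) ∩ reached Gc Go A D m t) ∪ (inNbrs Gc j ∩ A) := by
      intro a ha
      simp only [Finset.mem_inter, Finset.mem_union, Finset.mem_sdiff] at ha ⊢
      tauto
    have h1 := (Finset.card_le_card hsub).trans (Finset.card_union_le _ _)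
    have h2 := hlocal j hjA
    omega
  · obtain ⟨j, hjO, hj⟩ := Finset.not_subset.1 hO
    refine ⟨j, hj, ?_⟩
    rw [reached]
    exact Finset.mem_union_left _ (Finset.mem_union_right _ hjO)

/-- Counting from `{m} ∪ A` instead of `{m}` makes `N - ({m} ∪ A).card` rounds enough for the
truthful agents. With an adversary other than `m` this is at most `N - 2`, so level `N - 1` stays
free for the adversaries. -/
lemma card_reached (hlocal : IsLocalSet Gc D A) (hrobust : InfoRobust Gc Go (2 * D + 1) m) (t : ℕ) :
    min N (({m} ∪ A).card + t) ≤ (reached Gc Go A D m t ∪ A).card := by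
  induction t with
  | zero => simp [reached]
  | succ t ih =>
    have hmono : reached Gc Go A D m t ∪ A ⊆ reached Gc Go A D m (t + 1) ∪ A :=
      Finset.union_subset_union_left (reached_subset_succ t)
    by_cases hu : reached Gc Go A D m t ∪ A = Finset.univ
    · have := Finset.card_le_card hmono
      rw [hu, Finset.card_univ, Fintype.card_fin] at this
      omega
    · obtain ⟨j, hj, hj'⟩ := exists_reached_succ hlocal hrobust hu
      have : (reached Gc Go A D m t ∪ A).card < (reached Gc Go A D m (t + 1) ∪ A).card :=
        Finset.card_lt_card ((Finset.ssubset_iff_of_subset hmono).2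
          ⟨j, Finset.mem_union_left _ hj', hj⟩)
      omega

/-- There is a level function with values at most `N - 1` such that every truthful agent that does
not observe `m` has `D + 1` truthful in-neighbours of smaller level, and the level of an adversary
(other than `m`) exceeds that of every truthful agent. -/
lemma exists_level (hN : 2 ≤ N) (hlocal : IsLocalSet Gc D A)
    (hrobust : InfoRobust Gc Go (2 * D + 1) m) :
    ∃ lev : Fin N → ℕ, (∀ i, lev i ≤ N - 1) ∧ (∀ i, lev i = 0 ↔ i = m) ∧
      (∀ i ∉ A, ¬ Go.Adj m i → i ≠ m →
        D + 1 ≤ ((inNbrs Gc i \ A) ∩ Finset.univ.filter (fun l => lev l < lev i)).card) ∧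
      (∀ i ∈ A, i ≠ m → ∀ l ∉ A, lev l < lev i) := by
  classical
  have hall : ∀ i ∉ A, i ∈ reached Gc Go A D m (N - ({m} ∪ A).card) := by
    intro i hi
    have h1 := card_reached (t := N - ({m} ∪ A).card) hlocal hrobust
    have h2 : (reached Gc Go A D m (N - ({m} ∪ A).card) ∪ A) = Finset.univ := by
      rw [← Finset.card_eq_iff_eq_univ, Fintype.card_fin]
      have := Finset.card_le_univ (reached Gc Go A D m (N - ({m} ∪ A).card) ∪ A)
      rw [Fintype.card_fin] at this
      omega
    have := Finset.mem_univ i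
    rw [← h2] at this
    exact (Finset.mem_union.1 this).resolve_right hi
  -- For an agent that is never reached the set is empty and `sInf` returns `0`. Only adversaries
  -- can be affected, and `lev` overrides their value unless they are `m`.
  set first : Fin N → ℕ := fun i => sInf {t | i ∈ reached Gc Go A D m t} with hfirst
  have hfirst_le : ∀ i t, i ∈ reached Gc Go A D m t → first i ≤ t := fun i t h => Nat.sInf_le h
  have hfirst_mem : ∀ i ∉ A, i ∈ reached Gc Go A D m (first i) := fun i hi =>
    Nat.sInf_mem (s := {t | i ∈ reached Gc Go A D m t}) ⟨_, hall i hi⟩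
  have hm0 : first m = 0 := Nat.le_zero.1 (hfirst_le m 0 (mem_reached_self 0))
  set lev : Fin N → ℕ := fun i => if i ∈ A ∧ i ≠ m then N - 1 else first i with hlev
  have hlevT : ∀ i ∉ A, lev i = first i := fun i hi => by simp [hlev, hi]
  have hlevA : ∀ i ∈ A, i ≠ m → lev i = N - 1 := fun i hi him => by simp [hlev, hi, him]
  have hlevm : lev m = 0 := by simp [hlev, hm0]
  have hcard1 : 1 ≤ ({m} ∪ A).card := Finset.card_pos.2 ⟨m, by simp⟩
  have hTle : ∀ i ∉ A, lev i ≤ N - ({m} ∪ A).card := fun i hi => by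
    rw [hlevT i hi]; exact hfirst_le _ _ (hall i hi)
  refine ⟨lev, fun i => ?_, fun i => ⟨fun h => ?_, fun h => h ▸ hlevm⟩, fun i hi hO him => ?_,
    fun i hi him l hl => ?_⟩
  · by_cases hi : i ∈ A
    · by_cases him : i = m
      · rw [him, hlevm]; omega
      · rw [hlevA i hi him]
    · have := hTle i hi; omega
  · by_contra him
    by_cases hi : i ∈ A
    · rw [hlevA i hi him] at h; omega
    · have h1 := hfirst_mem i hi
      rw [← hlevT i hi, h] at h1
      exact him (by simpa [reached] using h1)
  · have h1 := hfirst_mem i hi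
    rw [← hlevT i hi] at h1
    obtain ⟨t, ht⟩ : ∃ t, lev i = t + 1 := Nat.exists_eq_succ_of_ne_zero fun h => him (by
      rw [h] at h1; simpa [reached] using h1)
    rw [ht, reached] at h1
    have hnot : i ∉ reached Gc Go A D m t := fun h => by
      have := hfirst_le i t h
      rw [← hlevT i hi, ht] at this
      omega
    have h2 : D + 1 ≤ ((inNbrs Gc i \ A) ∩ reached Gc Go A D m t).card := by
      simpa [hnot, mem_outNbrs, hO, hi] using h1
    refine h2.trans (Finset.card_le_card fun l hl => ?_)
    simp only [Finset.mem_inter, Finset.mem_sdiff, Finset.mem_filter, Finset.mem_univ,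
      true_and] at hl ⊢
    refine ⟨hl.1, ?_⟩
    have := hfirst_le l t hl.2
    rw [← hlevT l hl.1.2] at this
    omega
  · rw [hlevA i hi him]
    have h2 : 2 ≤ ({m} ∪ A).card := by
      have : ({m, i} : Finset (Fin N)) ⊆ {m} ∪ A := by
        intro a ha
        simp only [Finset.mem_insert, Finset.mem_singleton, Finset.mem_union] at ha ⊢
        rcases ha with rfl | rfl
        · exact Or.inl rfl
        · exact Or.inr hi
      have h3 := Finset.card_le_card this
      rwa [Finset.card_pair (Ne.symm him)] at h3
    have := hTle l hl
    omega

end Levels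

/-! ### Products of substochastic matrices with levels -/

/-- Substochastic matrices whose row and column of level `0` vanish and in which every other row
has weight at most `1 - ε` on the indices of the same or a higher level. -/
structure LevelSubstochastic {N : ℕ} (lev : Fin N → ℕ) (ε : ℝ) (B : Matrix (Fin N) (Fin N) ℝ) :
    Prop where
  nonneg : ∀ i l, 0 ≤ B i l
  row_sum : ∀ i, ∑ l, B i l ≤ 1
  row_zero : ∀ i l, lev i = 0 → B i l = 0
  col_zero : ∀ i l, lev l = 0 → B i l = 0
  high_sum : ∀ i, lev i ≠ 0 → ∑ l with ¬ lev l < lev i, B i l ≤ 1 - ε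

/-- Trajectory of `z ↦ B (k+1) z`, started in `z` at time `k`. -/
def traj {N : ℕ} (B : ℕ → Matrix (Fin N) (Fin N) ℝ) (k : ℕ) (z : Fin N → ℝ) : ℕ → Fin N → ℝ
  | 0 => z
  | l + 1 => (B (k + l + 1)).mulVec (traj B k z l)

section Traj

variable {N : ℕ} {B : ℕ → Matrix (Fin N) (Fin N) ℝ}

/-- Peels off the first step rather than the last, so that the energy at time `k + 1` becomes the
tail of the series of the energy at time `k`. -/
lemma traj_succ' (k : ℕ) (z : Fin N → ℝ) (l : ℕ) :
    traj B k z (l + 1) = traj B (k + 1) ((B (k + 1)).mulVec z) l := by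
  induction l with
  | zero => rfl
  | succ l ih =>
    rw [traj, ih, traj]
    congr 2
    omega

lemma traj_add_time (k : ℕ) (z : Fin N → ℝ) (s l : ℕ) :
    traj B k z (s + l) = traj B (k + s) (traj B k z s) l := by
  induction l with
  | zero => rfl
  | succ l ih =>
    rw [← add_assoc, traj, ih, traj]
    congr 2
    omega

lemma traj_add_smul (k : ℕ) (z w : Fin N → ℝ) (c : ℝ) (l : ℕ) :
    traj B k (z + c • w) l = traj B k z l + c • traj B k w l := by
  induction l with
  | zero => rfl
  | succ l ih => simp only [traj, ih, Matrix.mulVec_add, Matrix.mulVec_smul]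

lemma LevelSubstochastic.abs_mulVec_le {lev : Fin N → ℕ} {ε : ℝ} {B : Matrix (Fin N) (Fin N) ℝ}
    (hB : LevelSubstochastic lev ε B) {u : Fin N → ℝ} {M : ℝ} (hM : 0 ≤ M)
    (hu : ∀ i, |u i| ≤ M) (i : Fin N) : |B.mulVec u i| ≤ M := by
  calc |B.mulVec u i| = |∑ l, B i l * u l| := rfl
    _ ≤ ∑ l, |B i l * u l| := Finset.abs_sum_le_sum_abs _ _
    _ ≤ ∑ l, B i l * M := Finset.sum_le_sum fun l _ => by
        rw [abs_mul, abs_of_nonneg (hB.nonneg i l)]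
        exact mul_le_mul_of_nonneg_left (hu l) (hB.nonneg i l)
    _ = (∑ l, B i l) * M := by rw [Finset.sum_mul]
    _ ≤ 1 * M := mul_le_mul_of_nonneg_right (hB.row_sum i) hM
    _ = M := one_mul M

/-- With mass `a` on lower levels and `b ≤ 1 - ε` on the rest, `a (1 - ε^t) + b = (a + b)(1 - ε^t) +
b ε^t ≤ 1 - ε^(t+1)`. Thus a gain `ε^t` below becomes a gain `ε^(t+1)` one level higher. -/
lemma LevelSubstochastic.abs_mulVec_le_of_level {lev : Fin N → ℕ} {ε : ℝ}
    {B : Matrix (Fin N) (Fin N) ℝ} (hB : LevelSubstochastic lev ε B) (hε : 0 ≤ ε) (hε1 : ε ≤ 1)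
    {u : Fin N → ℝ} {M : ℝ} (hM : 0 ≤ M) (hu : ∀ i, |u i| ≤ M) {i : Fin N} {t : ℕ}
    (hi : lev i = t + 1)
    (hlow : ∀ l, lev l ≠ 0 → lev l < lev i → |u l| ≤ M * (1 - ε ^ t)) :
    |B.mulVec u i| ≤ M * (1 - ε ^ (t + 1)) := by
  have hεt : 0 ≤ ε ^ t := pow_nonneg hε t
  have hεt1 : ε ^ t ≤ 1 := pow_le_one₀ hε hε1
  set a := ∑ l with lev l < lev i, B i l with ha
  set b := ∑ l with ¬ lev l < lev i, B i l with hb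
  have hab : a + b ≤ 1 := by
    rw [ha, hb, Finset.sum_filter_add_sum_filter_not]; exact hB.row_sum i
  have hb1 : b ≤ 1 - ε := hB.high_sum i (by omega)
  have habs : |B.mulVec u i| ≤ a * (M * (1 - ε ^ t)) + b * M := by
    calc |B.mulVec u i| = |∑ l, B i l * u l| := rfl
      _ ≤ ∑ l, |B i l * u l| := Finset.abs_sum_le_sum_abs _ _
      _ = ∑ l with lev l < lev i, |B i l * u l| + ∑ l with ¬ lev l < lev i, |B i l * u l| :=
          (Finset.sum_filter_add_sum_filter_not _ _ _).symm
      _ ≤ _ := by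
        rw [ha, hb, Finset.sum_mul, Finset.sum_mul]
        refine add_le_add (Finset.sum_le_sum fun l hl => ?_) (Finset.sum_le_sum fun l _ => ?_)
        · by_cases h0 : lev l = 0
          · simp [hB.col_zero i l h0]
          · rw [abs_mul, abs_of_nonneg (hB.nonneg i l)]
            exact mul_le_mul_of_nonneg_left (hlow l h0 (Finset.mem_filter.1 hl).2) (hB.nonneg i l)
        · rw [abs_mul, abs_of_nonneg (hB.nonneg i l)]
          exact mul_le_mul_of_nonneg_left (hu l) (hB.nonneg i l)
  have h1 : (a + b) * (1 - ε ^ t) ≤ 1 * (1 - ε ^ t) :=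
    mul_le_mul_of_nonneg_right hab (by linarith)
  have h2 : b * ε ^ t ≤ (1 - ε) * ε ^ t := mul_le_mul_of_nonneg_right hb1 hεt
  have h3 : a * (1 - ε ^ t) + b ≤ 1 - ε ^ (t + 1) := by rw [pow_succ]; linarith
  calc _ ≤ _ := habs
    _ = M * (a * (1 - ε ^ t) + b) := by ring
    _ ≤ _ := mul_le_mul_of_nonneg_left h3 hM

variable {lev : Fin N → ℕ} {ε : ℝ} {k : ℕ} {z : Fin N → ℝ} {M : ℝ}

lemma abs_traj_le (hB : ∀ j, k < j → LevelSubstochastic lev ε (B j))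
    (hM : 0 ≤ M) (hz : ∀ i, |z i| ≤ M) (s : ℕ) (i : Fin N) : |traj B k z s i| ≤ M := by
  induction s generalizing i with
  | zero => exact hz i
  | succ s ih => exact (hB _ (by omega)).abs_mulVec_le hM ih i

/-- The gain climbs one level per step: lower levels already have it after `s` steps when level `s +
1` is treated. Since `ε ≤ 1`, levels further down have at least the gain needed. -/
lemma abs_traj_le_of_level (hB : ∀ j, k < j → LevelSubstochastic lev ε (B j)) (hε : 0 ≤ ε)
    (hε1 : ε ≤ 1) (hM : 0 ≤ M) (hz : ∀ i, |z i| ≤ M) (s : ℕ) (i : Fin N) (hi : lev i ≠ 0)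
    (his : lev i ≤ s) : |traj B k z s i| ≤ M * (1 - ε ^ lev i) := by
  induction s generalizing i with
  | zero => omega
  | succ s ih =>
    obtain ⟨t, ht⟩ := Nat.exists_eq_succ_of_ne_zero hi
    rw [ht]
    refine (hB _ (by omega)).abs_mulVec_le_of_level hε hε1 hM (abs_traj_le hB hM hz s) ht
      fun l hl hli => (ih l hl (by omega)).trans ?_
    have : ε ^ t ≤ ε ^ lev l := pow_le_pow_of_le_one hε hε1 (by omega)
    exact mul_le_mul_of_nonneg_left (by linarith) hM

/-- After as many steps as there are levels, the maximum norm has decreased by a fixed factor. -/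
lemma abs_traj_le_contraction {n : ℕ} (hn : n ≠ 0) (hlev : ∀ i, lev i ≤ n)
    (hB : ∀ j, k < j → LevelSubstochastic lev ε (B j)) (hε : 0 ≤ ε) (hε1 : ε ≤ 1)
    (hM : 0 ≤ M) (hz : ∀ i, |z i| ≤ M) (i : Fin N) : |traj B k z n i| ≤ M * (1 - ε ^ n) := by
  have hεn : ε ^ n ≤ 1 := pow_le_one₀ hε hε1
  by_cases hi : lev i = 0
  · obtain ⟨s, rfl⟩ := Nat.exists_eq_succ_of_ne_zero hn
    have : traj B k z (s + 1) i = 0 := by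
      rw [traj, Matrix.mulVec, dotProduct]
      exact Finset.sum_eq_zero fun l _ => by rw [(hB _ (by omega)).row_zero i l hi, zero_mul]
    rw [this, abs_zero]
    exact mul_nonneg hM (by linarith)
  · refine (abs_traj_le_of_level hB hε hε1 hM hz n i hi (hlev i)).trans ?_
    have : ε ^ n ≤ ε ^ lev i := pow_le_pow_of_le_one hε hε1 (hlev i)
    exact mul_le_mul_of_nonneg_left (by linarith) hM

lemma abs_traj_le_pow {n : ℕ} (hn : n ≠ 0) (hlev : ∀ i, lev i ≤ n)
    (hB : ∀ j, k < j → LevelSubstochastic lev ε (B j)) (hε : 0 ≤ ε) (hε1 : ε ≤ 1)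
    (hM : 0 ≤ M) (hz : ∀ i, |z i| ≤ M) (s : ℕ) (i : Fin N) :
    |traj B k z s i| ≤ M * (1 - ε ^ n) ^ (s / n) := by
  have hC : 0 ≤ 1 - ε ^ n := by linarith [pow_le_one₀ hε hε1 (n := n)]
  have hmul : ∀ (q : ℕ) (i : Fin N), |traj B k z (n * q) i| ≤ M * (1 - ε ^ n) ^ q := by
    intro q
    induction q with
    | zero => simpa [traj] using hz
    | succ q ih =>
      intro i
      rw [Nat.mul_succ, traj_add_time]
      refine (abs_traj_le_contraction hn hlev (fun j hj => hB j (by omega)) hε hε1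
        (by positivity) ih i).trans_eq ?_
      rw [pow_succ, mul_assoc]
  conv_lhs => rw [← Nat.div_add_mod s n, traj_add_time]
  exact abs_traj_le (fun j hj => hB j (by omega)) (by positivity) (hmul _) _ i

end Traj

/-! ### The quadratic Lyapunov function of a trajectory -/

section Energy

variable {N : ℕ} {B : ℕ → Matrix (Fin N) (Fin N) ℝ}

/-- `∑_l ‖Φ(k+l, k) z‖²`, where `Φ` is the transition matrix. -/
noncomputable def energy (B : ℕ → Matrix (Fin N) (Fin N) ℝ) (k : ℕ) (z : Fin N → ℝ) : ℝ :=
  ∑' l, ∑ i, traj B k z l i ^ 2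

lemma energy_nonneg (k : ℕ) (z : Fin N → ℝ) : 0 ≤ energy B k z :=
  tsum_nonneg fun _ => Finset.sum_nonneg fun _ _ => sq_nonneg _

/-- The squares of the maximum norms of all trajectories decay like `4 ρ ^ l`. -/
def SquareDecay {N : ℕ} (B : ℕ → Matrix (Fin N) (Fin N) ℝ) (ρ : ℝ) : Prop :=
  ∀ l : ℕ, ∃ c : ℝ, 0 ≤ c ∧ c ^ 2 ≤ 4 * ρ ^ l ∧
    ∀ (k : ℕ) (z : Fin N → ℝ) (M : ℝ), 0 ≤ M → (∀ i, |z i| ≤ M) → ∀ i, |traj B k z l i| ≤ M * c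

lemma squareDecay {lev : Fin N → ℕ} {ε ρ : ℝ} {n : ℕ} (hn : n ≠ 0) (hlev : ∀ i, lev i ≤ n)
    (hB : ∀ j, j ≠ 0 → LevelSubstochastic lev ε (B j)) (hε : 0 ≤ ε) (hε1 : ε ≤ 1)
    (hρ : ∀ l, ((1 - ε ^ n) ^ (l / n)) ^ 2 ≤ 4 * ρ ^ l) : SquareDecay B ρ := fun l =>
  ⟨(1 - ε ^ n) ^ (l / n), pow_nonneg (by linarith [pow_le_one₀ hε hε1 (n := n)]) _, hρ l,
    fun _ _ _ hM hz i =>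
      abs_traj_le_pow hn hlev (fun j hj => hB j (by omega)) hε hε1 hM hz l i⟩

variable {ρ : ℝ}

/-- Each of the `N` coordinates is bounded by the maximum norm; summing the geometric series over
`l` is what produces `4 * N / (1 - ρ)`. -/
lemma SquareDecay.sum_sq_le (hB : SquareDecay B ρ) {E : ℝ} (hE : 0 ≤ E) {e : Fin N → ℝ}
    (he : ∀ i, |e i| ≤ E) (k l : ℕ) : ∑ i, traj B k e l i ^ 2 ≤ E ^ 2 * (4 * N * ρ ^ l) := by
  obtain ⟨c, hc, hc2, hdec⟩ := hB l
  calc ∑ i, traj B k e l i ^ 2 ≤ ∑ _i : Fin N, E ^ 2 * (4 * ρ ^ l) := by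
        refine Finset.sum_le_sum fun i _ => ?_
        calc traj B k e l i ^ 2 = |traj B k e l i| ^ 2 := (sq_abs _).symm
          _ ≤ (E * c) ^ 2 := by gcongr; exact hdec k e E hE he i
          _ = E ^ 2 * c ^ 2 := by ring
          _ ≤ _ := by gcongr
    _ = _ := by simp; ring

lemma SquareDecay.summable (hB : SquareDecay B ρ) (hρ0 : 0 ≤ ρ) (hρ1 : ρ < 1) (k : ℕ)
    (e : Fin N → ℝ) : Summable fun l => ∑ i, traj B k e l i ^ 2 := by
  have he : ∀ i, |e i| ≤ ∑ j, |e j| := fun i =>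
    Finset.single_le_sum (f := fun j => |e j|) (fun j _ => abs_nonneg _) (Finset.mem_univ i)
  exact Summable.of_nonneg_of_le (fun l => Finset.sum_nonneg fun i _ => sq_nonneg _)
    (fun l => hB.sum_sq_le (Finset.sum_nonneg fun j _ => abs_nonneg _) he k l)
    (((summable_geometric_of_lt_one hρ0 hρ1).mul_left _).mul_left _)

lemma SquareDecay.summable_succ (hB : SquareDecay B ρ) (hρ0 : 0 ≤ ρ) (hρ1 : ρ < 1) (k : ℕ)
    (e : Fin N → ℝ) : Summable fun l => ∑ i, traj B k e (l + 1) i ^ 2 := by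
  simp only [traj_succ']
  exact hB.summable hρ0 hρ1 (k + 1) _

/-- By linearity the trajectory is that of `e` plus `c` times that of `1`. The square of the first
part is kept exactly, to be compared with the energy of `e`; only the cross term and the last square
are estimated by the decay. -/
lemma SquareDecay.sum_sq_add_le (hB : SquareDecay B ρ) {E : ℝ} (hE : 0 ≤ E) {e : Fin N → ℝ}
    (he : ∀ i, |e i| ≤ E) (c : ℝ) (k l : ℕ) :
    ∑ i, traj B k (e + c • 1) l i ^ 2 ≤
      ∑ i, traj B k e l i ^ 2 + (2 * |c| * E + c ^ 2) * (4 * N * ρ ^ l) := by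
  obtain ⟨r, hr, hr2, hdec⟩ := hB l
  have h1 : ∀ i, |traj B k 1 l i| ≤ r := fun i => by
    simpa using hdec k 1 1 zero_le_one (by simp) i
  calc ∑ i, traj B k (e + c • 1) l i ^ 2
      ≤ ∑ i, (traj B k e l i ^ 2 + (2 * |c| * E + c ^ 2) * (4 * ρ ^ l)) := by
        refine Finset.sum_le_sum fun i _ => ?_
        rw [traj_add_smul, Pi.add_apply, Pi.smul_apply, smul_eq_mul]
        have h2 : c * traj B k e l i * traj B k 1 l i ≤ |c| * (E * r) * r := by
          refine (le_abs_self _).trans ?_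
          rw [abs_mul, abs_mul]
          exact mul_le_mul (mul_le_mul_of_nonneg_left (hdec k e E hE he i) (abs_nonneg _)) (h1 i)
            (abs_nonneg _) (by positivity)
        have h3 : traj B k 1 l i ^ 2 ≤ r ^ 2 := by
          rw [← sq_abs]; gcongr; exact h1 i
        have h4 : c ^ 2 * traj B k 1 l i ^ 2 ≤ c ^ 2 * r ^ 2 := by gcongr
        have h5 : (2 * |c| * E + c ^ 2) * r ^ 2 ≤ (2 * |c| * E + c ^ 2) * (4 * ρ ^ l) := by
          gcongr
        linarith [add_sq (traj B k e l i) (c * traj B k 1 l i), mul_pow c (traj B k 1 l i) 2,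
          add_mul (2 * |c| * E) (c ^ 2) (r ^ 2)]
    _ = _ := by rw [Finset.sum_add_distrib]; simp; ring

/-- One step of the perturbed iteration `e ↦ B (e + c • 1)`. -/
lemma SquareDecay.energy_step_le (hB : SquareDecay B ρ) (hN : 1 ≤ N) (hρ0 : 0 ≤ ρ) (hρ1 : ρ < 1)
    {E : ℝ} (hE : 0 ≤ E) {e : Fin N → ℝ} (he : ∀ i, |e i| ≤ E) (c : ℝ) (k : ℕ) :
    energy B (k + 1) ((B (k + 1)).mulVec (e + c • 1)) ≤
      energy B k e - ∑ i, e i ^ 2 + (2 * |c| * E + c ^ 2) * (4 * N / (1 - ρ) - 1) := by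
  have hs := hB.summable hρ0 hρ1 k e
  have hs1 := hB.summable_succ hρ0 hρ1 k e
  have hs2 := hB.summable_succ hρ0 hρ1 k (e + c • 1)
  have hg : HasSum (fun l => 4 * (N : ℝ) * ρ ^ (l + 1)) (4 * N * ρ / (1 - ρ)) := by
    have := (hasSum_geometric_of_lt_one hρ0 hρ1).mul_left (4 * (N : ℝ) * ρ)
    rw [← div_eq_mul_inv] at this
    have heq : (fun l => 4 * (N : ℝ) * ρ * ρ ^ l) = fun l => 4 * (N : ℝ) * ρ ^ (l + 1) := by
      funext l; ring
    rwa [heq] at this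
  have hNr : (1 : ℝ) ≤ N := by exact_mod_cast hN
  have h1 : energy B (k + 1) ((B (k + 1)).mulVec (e + c • 1)) =
      ∑' l, ∑ i, traj B k (e + c • 1) (l + 1) i ^ 2 := by
    rw [energy]
    exact tsum_congr fun l => by rw [traj_succ']
  have h2 : energy B k e = ∑ i, e i ^ 2 + ∑' l, ∑ i, traj B k e (l + 1) i ^ 2 :=
    hs.tsum_eq_zero_add
  have hs3 : Summable fun l => (2 * |c| * E + c ^ 2) * (4 * (N : ℝ) * ρ ^ (l + 1)) :=
    hg.summable.mul_left _
  have h3 : ∑' l, ∑ i, traj B k (e + c • 1) (l + 1) i ^ 2 ≤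
      ∑' l, ∑ i, traj B k e (l + 1) i ^ 2 +
        (2 * |c| * E + c ^ 2) * (4 * N * ρ / (1 - ρ)) := by
    rw [← hg.tsum_eq, ← tsum_mul_left, ← hs1.tsum_add hs3]
    exact hs2.tsum_le_tsum (fun l => hB.sum_sq_add_le hE he c k (l + 1)) (hs1.add hs3)
  -- The series starts at `l = 1`, so the term `4 * N` is missing; giving up all of it but `1`
  -- yields the constant `p̄ - 1`.
  have h4 : 4 * (N : ℝ) * ρ / (1 - ρ) ≤ 4 * N / (1 - ρ) - 1 := by
    have : (0 : ℝ) < 1 - ρ := by linarith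
    rw [le_sub_iff_add_le, div_add' _ _ _ this.ne']
    gcongr
    nlinarith
  have h5 : (2 * |c| * E + c ^ 2) * (4 * (N : ℝ) * ρ / (1 - ρ)) ≤
      (2 * |c| * E + c ^ 2) * (4 * N / (1 - ρ) - 1) := by gcongr
  linarith

end Energy

/-- The rate `ρ = C ^ (2 / (N - 1))` dominates the decay by `C` in every `N - 1` steps. -/
lemma contractionC_pow_sq_le {N : ℕ} (hN : 2 ≤ N) {η : ℝ} (hη : 0 < η) (hη1 : η ≤ 1) (l : ℕ) :
    (contractionC N η ^ (l / (N - 1))) ^ 2 ≤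
      4 * (Real.rpow (contractionC N η) (2 / ((N : ℝ) - 1))) ^ l := by
  have hpow : (η / 2) ^ (N - 1) ≤ 1 / 2 := by
    calc (η / 2) ^ (N - 1) ≤ (η / 2) ^ 1 :=
          pow_le_pow_of_le_one (by linarith) (by linarith) (by omega)
      _ ≤ 1 / 2 := by rw [pow_one]; linarith
  have hpos : 0 < (η / 2) ^ (N - 1) := by positivity
  set C := contractionC N η with hC
  have hC2 : 1 / 2 ≤ C := by rw [hC, contractionC]; linarith
  have hC1 : C ≤ 1 := by rw [hC, contractionC]; linarith
  have hC0 : 0 < C := by linarith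
  have hn : ((N - 1 : ℕ) : ℝ) = (N : ℝ) - 1 := by push_cast [Nat.cast_sub (by omega : 1 ≤ N)]; rfl
  have hn0 : (0 : ℝ) < (N : ℝ) - 1 := by rw [← hn]; exact_mod_cast (by omega : 0 < N - 1)
  set q := l / (N - 1) with hq
  -- Rounding `l / (N - 1)` down costs at most one factor `C ^ 2`. As `η / 2 ≤ 1 / 2` gives `C ≥ 1 /
  -- 2`, the factor `4` absorbs it.
  have hlq : l ≤ (N - 1) * (q + 1) := by
    have := Nat.div_add_mod l (N - 1)
    have := Nat.mod_lt l (by omega : 0 < N - 1)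
    rw [← hq] at *
    rw [mul_add]; omega
  have hlq' : (l : ℝ) ≤ ((N : ℝ) - 1) * (q + 1) := by
    rw [← hn]; exact_mod_cast hlq
  have h1 : C ^ (2 * (q + 1)) ≤ (Real.rpow C (2 / ((N : ℝ) - 1))) ^ l := by
    rw [Real.rpow_eq_pow, ← Real.rpow_mul_natCast hC0.le, ← Real.rpow_natCast]
    refine Real.rpow_le_rpow_of_exponent_ge hC0 hC1 ?_
    push_cast
    rw [div_mul_eq_mul_div, div_le_iff₀ hn0]
    linarith
  have h2 : C ^ (2 * (q + 1)) = (C ^ q) ^ 2 * C ^ 2 := by ring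
  have h3 : (C ^ q) ^ 2 * 1 ≤ (C ^ q) ^ 2 * (4 * C ^ 2) := by
    gcongr
    nlinarith
  linarith

lemma rpow_contractionC_lt_one {N : ℕ} (hN : 2 ≤ N) {η : ℝ} (hη : 0 < η) (hη1 : η ≤ 1) :
    0 ≤ Real.rpow (contractionC N η) (2 / ((N : ℝ) - 1)) ∧
      Real.rpow (contractionC N η) (2 / ((N : ℝ) - 1)) < 1 := by
  have hpow : (η / 2) ^ (N - 1) ≤ 1 := pow_le_one₀ (by linarith) (by linarith)
  have hpos : 0 < (η / 2) ^ (N - 1) := by positivity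
  have hC0 : 0 ≤ contractionC N η := by rw [contractionC]; linarith
  have hC1 : contractionC N η < 1 := by rw [contractionC]; linarith
  have hN' : (2 : ℝ) ≤ N := by exact_mod_cast hN
  exact ⟨Real.rpow_nonneg hC0 _, Real.rpow_lt_one hC0 hC1 (div_pos two_pos (by linarith))⟩

lemma one_le_pBar {N : ℕ} (hN : 2 ≤ N) {η : ℝ} (hη : 0 < η) (hη1 : η ≤ 1) : 1 ≤ pBar N η := by
  obtain ⟨h0, h1⟩ := rpow_contractionC_lt_one hN hη hη1
  have hN' : (2 : ℝ) ≤ N := by exact_mod_cast hN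
  rw [pBar, le_div_iff₀ (by linarith)]
  linarith


/-! ### Game theory -/

section Game

variable {N : ℕ} {d : Fin N → ℕ}

lemma block_apply (x : Profile d) (i : Fin N) (q : Fin (d i)) : block x i q = x ⟨i, q⟩ := rfl

lemma setBlock_apply_same (x : Profile d) (i : Fin N) (t : Action d i) (q : Fin (d i)) :
    setBlock x i t ⟨i, q⟩ = t q := by
  simp [setBlock]

lemma setBlock_apply_of_ne (x : Profile d) {i : Fin N} (t : Action d i)
    {p : (m : Fin N) × Fin (d m)} (h : p.1 ≠ i) : setBlock x i t p = x p := by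
  simp [setBlock, h]

lemma setBlock_block (x : Profile d) (i : Fin N) : setBlock x i (block x i) = x := by
  ext ⟨m, q⟩
  by_cases h : m = i
  · subst h; rw [setBlock_apply_same, block_apply]
  · rw [setBlock_apply_of_ne x _ h]

lemma pseudoGrad_apply (J : Fin N → Profile d → ℝ) (x : Profile d) (m : Fin N) (q : Fin (d m)) :
    pseudoGrad J x ⟨m, q⟩ = partialGrad J m x q := rfl

variable {J : Fin N → Profile d → ℝ} {μ : ℝ} {L : NNReal}

/-- Along the line through `x` and `y` the function is convex on `ℝ` with derivative zero at `0`,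
which is therefore a minimum. -/
lemma le_of_convexOn_of_hasFDerivAt_zero {E : Type*} [NormedAddCommGroup E] [NormedSpace ℝ E]
    {f : E → ℝ} (hf : ConvexOn ℝ Set.univ f) {x : E} (hd : HasFDerivAt f (0 : E →L[ℝ] ℝ) x)
    (y : E) : f x ≤ f y := by
  have hconv : ConvexOn ℝ Set.univ (f ∘ AffineMap.lineMap (k := ℝ) x y) := by
    simpa using hf.comp_affineMap (AffineMap.lineMap (k := ℝ) x y)
  have hder : HasDerivAt (f ∘ AffineMap.lineMap (k := ℝ) x y) 0 0 := by
    have h1 : HasFDerivAt f (0 : E →L[ℝ] ℝ) (AffineMap.lineMap (k := ℝ) x y (0 : ℝ)) := by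
      simpa using hd
    simpa using h1.comp_hasDerivAt (0 : ℝ) AffineMap.hasDerivAt_lineMap
  have := hconv.isMinOn_of_rightDeriv_eq_zero (x := 0) (by simp)
    (hder.hasDerivWithinAt.derivWithin (uniqueDiffWithinAt_Ioi 0))
  simpa using this (Set.mem_univ (1 : ℝ))

/-- Nash equilibria are the zeros of the pseudo-gradient. -/
lemma RegularGame.isNash_iff (hJ : RegularGame J μ L) (x : Profile d) :
    IsNash J x ↔ pseudoGrad J x = 0 := by
  have hdiff : ∀ i, DifferentiableAt ℝ (fun t : Action d i => J i (setBlock x i t)) (block x i) :=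
    fun i => (hJ.contDiff i x).differentiable one_ne_zero _
  have hzero : pseudoGrad J x = 0 ↔ ∀ i, partialGrad J i x = 0 := by
    constructor
    · intro h i
      ext q
      rw [← pseudoGrad_apply, h]; rfl
    · intro h
      ext ⟨m, q⟩
      rw [pseudoGrad_apply, h]; rfl
  rw [hzero]
  refine forall_congr' fun i => ?_
  have hgrad := (hdiff i).hasGradientAt.hasFDerivAt
  change _ ↔ gradient (fun t : Action d i => J i (setBlock x i t)) (block x i) = 0
  constructor
  · intro h
    have hmin : IsLocalMin (fun t : Action d i => J i (setBlock x i t)) (block x i) :=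
      Filter.Eventually.of_forall fun t => by simpa only [setBlock_block] using h t
    rw [gradient, hmin.fderiv_eq_zero, map_zero]
  · intro h t
    rw [h, map_zero] at hgrad
    simpa only [setBlock_block] using
      le_of_convexOn_of_hasFDerivAt_zero (hJ.convex i x) hgrad t

lemma RegularGame.eq_of_pseudoGrad_eq_zero (hJ : RegularGame J μ L) {x y : Profile d}
    (hx : pseudoGrad J x = 0) (hy : pseudoGrad J y = 0) : x = y := by
  have h := hJ.stronglyMonotone x y
  rw [hx, hy, sub_zero, inner_zero_right] at h
  have h2 : ‖x - y‖ ^ 2 ≤ 0 := by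
    by_contra hlt
    have := mul_pos hJ.mu_pos (not_le.1 hlt)
    linarith
  have h3 : ‖x - y‖ = 0 := by nlinarith [norm_nonneg (x - y)]
  exact sub_eq_zero.1 (norm_eq_zero.1 h3)

/-- A strongly monotone Lipschitz pseudo-gradient has a zero. -/
lemma RegularGame.exists_pseudoGrad_eq_zero (hJ : RegularGame J μ L) {α : ℝ} (hα : 0 < α)
    (hαL : α ^ 2 * (L : ℝ) ^ 2 < 2 * α * μ) : ∃ x, pseudoGrad J x = 0 := by
  -- The squared Lipschitz constant of the gradient step. It may be negative if the profile space is
  -- trivial, so the square roots below avoid any sign assumption on `q`.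
  set q : ℝ := 1 - 2 * α * μ + α ^ 2 * (L : ℝ) ^ 2 with hq
  have hq1 : q < 1 := by linarith
  have hstep : ∀ x y : Profile d, ‖(x - α • pseudoGrad J x) - (y - α • pseudoGrad J y)‖ ^ 2 ≤
      q * ‖x - y‖ ^ 2 := by
    intro x y
    have h1 : (x - α • pseudoGrad J x) - (y - α • pseudoGrad J y) =
        (x - y) - α • (pseudoGrad J x - pseudoGrad J y) := by rw [smul_sub]; abel
    rw [h1, norm_sub_sq_real, real_inner_smul_right, norm_smul, Real.norm_eq_abs, mul_pow, sq_abs]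
    have h2 := mul_le_mul_of_nonneg_left (hJ.stronglyMonotone x y) hα.le
    have h3 : ‖pseudoGrad J x - pseudoGrad J y‖ ≤ L * ‖x - y‖ := by
      simpa [dist_eq_norm] using hJ.lipschitz.dist_le_mul x y
    have h4 : ‖pseudoGrad J x - pseudoGrad J y‖ ^ 2 ≤ (L * ‖x - y‖) ^ 2 := by gcongr
    have h5 := mul_le_mul_of_nonneg_left h4 (sq_nonneg α)
    rw [hq]
    nlinarith
  have hcontr : ContractingWith (Real.toNNReal (Real.sqrt q))
      (fun x : Profile d => x - α • pseudoGrad J x) := by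
    refine ⟨?_, LipschitzWith.of_dist_le_mul fun x y => ?_⟩
    · rw [Real.toNNReal_lt_one, Real.sqrt_lt' one_pos]; simpa using hq1
    · rw [Real.coe_toNNReal _ (Real.sqrt_nonneg q), dist_eq_norm, dist_eq_norm]
      have := Real.sqrt_le_sqrt (hstep x y)
      rwa [Real.sqrt_mul' _ (sq_nonneg _), Real.sqrt_sq (norm_nonneg _),
        Real.sqrt_sq (norm_nonneg _)] at this
  refine ⟨hcontr.fixedPoint, ?_⟩
  have h := hcontr.fixedPoint_isFixedPt
  have h2 : α • pseudoGrad J hcontr.fixedPoint = 0 := by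
    have : hcontr.fixedPoint - α • pseudoGrad J hcontr.fixedPoint = hcontr.fixedPoint := h
    rwa [sub_eq_self] at this
  exact (smul_eq_zero.1 h2).resolve_left hα.ne'

/-- If every player evaluates its gradient at its own estimate, the resulting vector differs from
the pseudo-gradient by at most `L` times the total estimation error. -/
lemma RegularGame.sum_sq_sub_le (hJ : RegularGame J μ L) (X : Profile d) (v : Fin N → Profile d) :
    ∑ p : (m : Fin N) × Fin (d m), (pseudoGrad J (v p.1) p - pseudoGrad J X p) ^ 2 ≤
      (L : ℝ) ^ 2 * ∑ i, ‖v i - X‖ ^ 2 := by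
  rw [Finset.mul_sum, Fintype.sum_sigma]
  refine Finset.sum_le_sum fun m _ => ?_
  have h1 : ‖pseudoGrad J (v m) - pseudoGrad J X‖ ≤ L * ‖v m - X‖ := by
    simpa [dist_eq_norm] using hJ.lipschitz.dist_le_mul (v m) X
  calc ∑ q : Fin (d m), (pseudoGrad J (v m) ⟨m, q⟩ - pseudoGrad J X ⟨m, q⟩) ^ 2
      ≤ ∑ m', ∑ q : Fin (d m'), (pseudoGrad J (v m) ⟨m', q⟩ - pseudoGrad J X ⟨m', q⟩) ^ 2 :=
        Finset.single_le_sum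
          (f := fun m' => ∑ q : Fin (d m'),
            (pseudoGrad J (v m) ⟨m', q⟩ - pseudoGrad J X ⟨m', q⟩) ^ 2)
          (fun m' _ => Finset.sum_nonneg fun _ _ => sq_nonneg _) (Finset.mem_univ m)
    _ = ‖pseudoGrad J (v m) - pseudoGrad J X‖ ^ 2 := by
        rw [EuclideanSpace.norm_sq_eq, Fintype.sum_sigma]
        simp
    _ ≤ (L * ‖v m - X‖) ^ 2 := by gcongr
    _ = _ := by ring

end Game

/-! ### The quadratic form of the step-size condition -/

/-- A positive definite binary quadratic form is bounded below by a multiple of `x² + y²`. -/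
lemma exists_pos_le_of_posDef {a b c : ℝ} (h : (!![a, b; b, c] : Matrix (Fin 2) (Fin 2) ℝ).PosDef) :
    ∃ r > 0, ∀ x y : ℝ, r * (x ^ 2 + y ^ 2) ≤ a * x ^ 2 + 2 * b * x * y + c * y ^ 2 := by
  have hform : ∀ x y : ℝ, x ≠ 0 ∨ y ≠ 0 → 0 < a * x ^ 2 + 2 * b * x * y + c * y ^ 2 := by
    intro x y hxy
    have h1 : (![x, y] : Fin 2 → ℝ) ≠ 0 := by
      intro h0
      have h2 := congrFun h0 0
      have h3 := congrFun h0 1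
      simp at h2 h3
      tauto
    have := h.dotProduct_mulVec_pos h1
    simp [Matrix.mulVec, dotProduct, Fin.sum_univ_two] at this
    linarith
  have ha : 0 < a := by simpa using hform 1 0 (by simp)
  have hc : 0 < c := by simpa using hform 0 1 (by simp)
  have hdet : 0 < a * c - b ^ 2 := by
    -- On the vector `(-b, a)` the form equals `a` times the determinant.
    have h1 := hform (-b) a (Or.inr ha.ne')
    have h2 : a * (-b) ^ 2 + 2 * b * (-b) * a + c * a ^ 2 = a * (a * c - b ^ 2) := by ring
    rw [h2] at h1
    exact pos_of_mul_pos_right h1 ha.le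
  have hac : 0 < a + c := by linarith
  -- Determinant over trace lies below both eigenvalues. After multiplication by the trace, the
  -- difference of the two sides is `(a x + b y)² + (b x + c y)²`.
  refine ⟨(a * c - b ^ 2) / (a + c), div_pos hdet hac, fun x y => ?_⟩
  rw [div_mul_eq_mul_div, div_le_iff₀ hac]
  nlinarith [sq_nonneg (a * x + b * y), sq_nonneg (b * x + c * y)]


/-! ### Executions -/

section Execution

variable {N : ℕ} {d : Fin N → ℕ} {J : Fin N → Profile d → ℝ} {Gc Go : Digraph (Fin N)}
  {A : Finset (Fin N)} {D : ℕ} {η α : ℝ} {x v : ℕ → Fin N → Profile d}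
  {y : ℕ → Fin N → Fin N → Profile d}

/-- The profile of the actions that are played. -/
noncomputable def played (x : ℕ → Fin N → Profile d) (k : ℕ) : Profile d :=
  WithLp.toLp 2 fun p => x k p.1 p

/-- The gradients that the agents compute at their intermediate estimates. -/
noncomputable def usedGrad (J : Fin N → Profile d → ℝ) (v : ℕ → Fin N → Profile d) (k : ℕ) :
    Profile d :=
  WithLp.toLp 2 fun p => pseudoGrad J (v k p.1) p

/-- The errors of the intermediate estimates of the component `p`. -/
noncomputable def estError (x v : ℕ → Fin N → Profile d) (k : ℕ) (p : (m : Fin N) × Fin (d m)) :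
    Fin N → ℝ :=
  fun i => v k i p - played x k p

lemma IsExecution.next_of_ne (h : IsExecution J Gc Go A D η α x v y) (k : ℕ) {i : Fin N}
    {p : (m : Fin N) × Fin (d m)} (hp : p.1 ≠ i) : x (k + 1) i p = v k i p := by
  rw [h.gradient_step]
  simp [setBlock_apply_of_ne _ _ hp]

lemma IsExecution.played_succ (h : IsExecution J Gc Go A D η α x v y) (hself : ∀ i, Go.Adj i i)
    {k : ℕ} (hk : k ≠ 0) : played x (k + 1) = played x k - α • usedGrad J v k := by
  ext ⟨m, q⟩
  have h1 := h.observed k hk m m q (hself m)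
  simp [played, usedGrad, h.gradient_step, setBlock_apply_same, h1, pseudoGrad_apply]

/-- Here the adversarial messages disappear: truthful and adversarial agents alike average the
genuine estimates `x k l`, with weight at least `η` on lower levels. For an adversary this holds
because all truthful agents lie below it. -/
lemma IsExecution.exists_weights (h : IsExecution J Gc Go A D η α x v y)
    (hself : ∀ i, Go.Adj i i) (hlocal : IsLocalSet Gc D A) (hη : 0 < η) {m : Fin N}
    {lev : Fin N → ℕ}
    (hT : ∀ i ∉ A, ¬ Go.Adj m i → i ≠ m →
      D + 1 ≤ ((inNbrs Gc i \ A) ∩ Finset.univ.filter (fun l => lev l < lev i)).card)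
    (hA : ∀ i ∈ A, i ≠ m → ∀ l ∉ A, lev l < lev i)
    {k : ℕ} (hk : k ≠ 0) (q : Fin (d m)) {i : Fin N} (hi : ¬ Go.Adj m i) :
    ∃ a : Fin N → ℝ, (∀ l, 0 ≤ a l) ∧ ∑ l, a l = 1 ∧ η ≤ ∑ l with lev l < lev i, a l ∧
      v k i ⟨m, q⟩ = ∑ l, a l * x k l ⟨m, q⟩ := by
  have him : i ≠ m := fun h => hi (h ▸ hself m)
  have hmsg : ∀ l, l ∈ inNbrs Gc i \ A ∨ l = i → y k i l = x k l := by
    rintro l (hl | rfl)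
    · obtain ⟨hl1, hl2⟩ := Finset.mem_sdiff.1 hl
      exact h.truthful_message k l hl2 i (mem_inNbrs.1 hl1)
    · exact h.self_message k l
  have hconv : ∀ a : Fin N → ℝ, (∀ l, l ∉ inNbrs Gc i \ A → l ≠ i → a l = 0) →
      ∑ l, a l * y k i l ⟨m, q⟩ = ∑ l, a l * x k l ⟨m, q⟩ := by
    refine fun a ha => Finset.sum_congr rfl fun l _ => ?_
    by_cases hl : l ∈ inNbrs Gc i \ A ∨ l = i
    · rw [hmsg l hl]
    · rw [not_or] at hl
      rw [ha l hl.1 hl.2, zero_mul, zero_mul]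
  by_cases hiA : i ∈ A
  · obtain ⟨w, hw0, hwz, hw1, hwη, hout⟩ := h.adversary_average k hk i hiA m q hi
    refine ⟨w, hw0, hw1, hwη.trans ?_, hout.trans (hconv w hwz)⟩
    refine Finset.sum_le_sum_of_subset_of_nonneg (fun l hl => ?_) fun l _ _ => hw0 l
    exact Finset.mem_filter.2 ⟨Finset.mem_univ _, hA i hiA him l (Finset.mem_sdiff.1 hl).2⟩
  · obtain ⟨a, ha0, haz, ha1, haη, hout⟩ := (h.truthful_average k hk i hiA m q hi).exists_weights
      hη.le (by rw [h.self_message]) (hlocal i hiA) (hT i hiA hi him)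
    exact ⟨a, ha0, ha1, haη, hout.trans (hconv a haz)⟩

/-- The errors of the intermediate estimates are obtained from those of the estimates by a
substochastic matrix. -/
lemma IsExecution.exists_matrix (h : IsExecution J Gc Go A D η α x v y)
    (hself : ∀ i, Go.Adj i i) (hlocal : IsLocalSet Gc D A) (hη : 0 < η) {m : Fin N}
    {lev : Fin N → ℕ} (h0 : ∀ i, lev i = 0 ↔ i = m)
    (hT : ∀ i ∉ A, ¬ Go.Adj m i → i ≠ m →
      D + 1 ≤ ((inNbrs Gc i \ A) ∩ Finset.univ.filter (fun l => lev l < lev i)).card)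
    (hA : ∀ i ∈ A, i ≠ m → ∀ l ∉ A, lev l < lev i) (hη1 : η ≤ 1)
    {k : ℕ} (hk : k ≠ 0) (q : Fin (d m)) :
    ∃ B : Matrix (Fin N) (Fin N) ℝ, LevelSubstochastic lev (η / 2) B ∧
      estError x v k ⟨m, q⟩ = B.mulVec fun l => x k l ⟨m, q⟩ - played x k ⟨m, q⟩ := by
  classical
  have hex : ∀ i, ∃ b : Fin N → ℝ, (∀ l, 0 ≤ b l) ∧ ∑ l, b l ≤ 1 ∧ (i = m → b = 0) ∧ b m = 0 ∧
      ∑ l with ¬ lev l < lev i, b l ≤ 1 - η / 2 ∧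
      v k i ⟨m, q⟩ - played x k ⟨m, q⟩ =
        ∑ l, b l * (x k l ⟨m, q⟩ - played x k ⟨m, q⟩) := by
    intro i
    by_cases hi : Go.Adj m i
    · refine ⟨0, fun _ => le_rfl, by simp, fun _ => rfl, rfl, ?_, ?_⟩
      · simp only [Pi.zero_apply, Finset.sum_const_zero]; linarith
      · rw [h.observed k hk i m q hi]; simp [played]
    · obtain ⟨a, ha0, ha1, haη, hout⟩ := h.exists_weights hself hlocal hη hT hA hk q hi
      -- Agent `m` makes no error about its own action, so its weight can be set to zero without
      -- changing the averaged error. This gives the vanishing column.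
      have hle : ∀ l, Function.update a m 0 l ≤ a l := fun l => by
        by_cases hl : l = m
        · subst hl; simpa using ha0 l
        · simp [hl]
      refine ⟨Function.update a m 0, fun l => ?_, ?_, fun him => ?_, by simp, ?_, ?_⟩
      · by_cases hl : l = m
        · subst hl; simp
        · simpa [hl] using ha0 l
      · exact (Finset.sum_le_sum fun l _ => hle l).trans_eq ha1
      · exact absurd (him ▸ hself m) hi
      · have h1 := Finset.sum_filter_add_sum_filter_not Finset.univ (fun l => lev l < lev i) a
        have h2 : ∑ l with ¬ lev l < lev i, Function.update a m 0 l ≤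
            ∑ l with ¬ lev l < lev i, a l := Finset.sum_le_sum fun l _ => hle l
        linarith
      · have h1 : ∀ l, Function.update a m 0 l * (x k l ⟨m, q⟩ - played x k ⟨m, q⟩) =
            a l * x k l ⟨m, q⟩ - a l * played x k ⟨m, q⟩ := fun l => by
          by_cases hl : l = m
          · subst hl; simp [played]
          · simp [hl, mul_sub]
        simp only [h1]
        rw [Finset.sum_sub_distrib, ← Finset.sum_mul, ha1, one_mul, hout]
  choose B hB0 hB1 hBr hBc hBh hB using hex
  refine ⟨Matrix.of B, ⟨fun i l => hB0 i l, fun i => hB1 i, fun i l hi => ?_, fun i l hl => ?_,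
    fun i _ => hBh i⟩, ?_⟩
  · rw [Matrix.of_apply, hBr i ((h0 i).1 hi)]; rfl
  · rw [Matrix.of_apply, (h0 l).1 hl, hBc i]
  · funext i
    exact hB i

/-- The error recursion of one component. -/
lemma IsExecution.exists_recursion (h : IsExecution J Gc Go A D η α x v y) (hN : 2 ≤ N)
    (hself : ∀ i, Go.Adj i i) (hlocal : IsLocalSet Gc D A)
    (hrobust : ∀ m, InfoRobust Gc Go (2 * D + 1) m) (hη : 0 < η) (hη1 : η ≤ 1)
    (p : (m : Fin N) × Fin (d m)) :
    ∃ B : ℕ → Matrix (Fin N) (Fin N) ℝ,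
      SquareDecay B (Real.rpow (contractionC N η) (2 / ((N : ℝ) - 1))) ∧
      ∀ k, k ≠ 0 → estError x v (k + 1) p =
        (B (k + 1)).mulVec (estError x v k p + (α * usedGrad J v k p) • 1) := by
  obtain ⟨m, q⟩ := p
  obtain ⟨lev, hlev, h0, hT, hA⟩ := exists_level hN hlocal (hrobust m)
  have hex : ∀ k, ∃ B : Matrix (Fin N) (Fin N) ℝ, k ≠ 0 → LevelSubstochastic lev (η / 2) B ∧
      estError x v k ⟨m, q⟩ = B.mulVec fun l => x k l ⟨m, q⟩ - played x k ⟨m, q⟩ := by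
    intro k
    by_cases hk : k = 0
    · exact ⟨0, fun h => absurd hk h⟩
    · obtain ⟨B, hB⟩ := h.exists_matrix hself hlocal hη h0 hT hA hη1 hk q
      exact ⟨B, fun _ => hB⟩
  choose B hB using hex
  refine ⟨B, squareDecay (by omega) hlev (fun j hj => (hB j hj).1) (by linarith) (by linarith)
    fun l => contractionC_pow_sq_le hN hη hη1 l, fun k hk => ?_⟩
  obtain ⟨hsub, herr⟩ := hB (k + 1) (Nat.succ_ne_zero k)
  rw [herr]
  funext i
  simp only [Matrix.mulVec, dotProduct]
  refine Finset.sum_congr rfl fun l _ => ?_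
  -- The gradient step does not touch the estimates of agents other than `m`, while the action
  -- itself moves by `-α g`; relative to it, all their errors shift by `α g`. Agent `m` breaks this
  -- pattern, but its column is zero.
  by_cases hl : l = m
  · rw [hsub.col_zero i l ((h0 l).2 hl), zero_mul, zero_mul]
  · congr 1
    rw [h.next_of_ne k (p := ⟨m, q⟩) (fun hm => hl hm.symm), h.played_succ hself hk]
    simp [estError]
    ring

/-- Total squared error of the intermediate estimates. -/
lemma sum_estError_sq (x v : ℕ → Fin N → Profile d) (k : ℕ) :
    ∑ p, ∑ i, estError x v k p i ^ 2 = ∑ i, ‖v k i - played x k‖ ^ 2 := by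
  rw [Finset.sum_comm]
  refine Finset.sum_congr rfl fun i _ => ?_
  rw [EuclideanSpace.norm_sq_eq]
  simp [estError]

variable {μ : ℝ} {L : NNReal}

lemma RegularGame.norm_usedGrad_sub_le (hJ : RegularGame J μ L) (k : ℕ) :
    ‖usedGrad J v k - pseudoGrad J (played x k)‖ ≤
      L * √(∑ i, ‖v k i - played x k‖ ^ 2) := by
  have h1 : ‖usedGrad J v k - pseudoGrad J (played x k)‖ ^ 2 ≤
      (L : ℝ) ^ 2 * ∑ i, ‖v k i - played x k‖ ^ 2 := by
    rw [EuclideanSpace.norm_sq_eq]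
    simpa [usedGrad] using hJ.sum_sq_sub_le (played x k) (v k)
  have h2 := Real.sqrt_le_sqrt h1
  rwa [Real.sqrt_sq (norm_nonneg _), Real.sqrt_mul (sq_nonneg _), Real.sqrt_sq L.coe_nonneg] at h2

/-- Sum over all components of the energy estimates for one step. -/
lemma sum_energy_step_le {ι : Type*} [Fintype ι] {ρ : ℝ} (hN : 1 ≤ N) (hρ0 : 0 ≤ ρ) (hρ1 : ρ < 1)
    {B : ι → ℕ → Matrix (Fin N) (Fin N) ℝ} (hB : ∀ p, SquareDecay (B p) ρ)
    (hP : 1 ≤ 4 * (N : ℝ) / (1 - ρ)) (hα : 0 ≤ α) (e : ι → Fin N → ℝ) (g : ι → ℝ) (k : ℕ) :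
    ∑ p, energy (B p) (k + 1) ((B p (k + 1)).mulVec (e p + (α * g p) • 1)) ≤
      ∑ p, energy (B p) k (e p) - ∑ p, ∑ i, e p i ^ 2 +
        (2 * α * (√(∑ p, g p ^ 2) * √(∑ p, ∑ i, e p i ^ 2)) + α ^ 2 * ∑ p, g p ^ 2) *
          (4 * N / (1 - ρ) - 1) := by
  have hsq : ∀ p, 0 ≤ ∑ i, e p i ^ 2 := fun p => Finset.sum_nonneg fun i _ => sq_nonneg _
  -- The maximum norm of each component is replaced by the Euclidean norm, so that Cauchy–Schwarz
  -- over the components gives total norms.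
  have hle : ∀ p i, |e p i| ≤ √(∑ i, e p i ^ 2) := fun p i => by
    rw [← Real.sqrt_sq_eq_abs]
    exact Real.sqrt_le_sqrt (Finset.single_le_sum (f := fun i => e p i ^ 2)
      (fun i _ => sq_nonneg _) (Finset.mem_univ i))
  have h1 : ∑ p, |g p| * √(∑ i, e p i ^ 2) ≤ √(∑ p, g p ^ 2) * √(∑ p, ∑ i, e p i ^ 2) := by
    have := Real.sum_mul_le_sqrt_mul_sqrt Finset.univ (fun p => |g p|)
      (fun p => √(∑ i, e p i ^ 2))
    simpa only [sq_abs, Real.sq_sqrt (hsq _)] using this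
  calc _ ≤ ∑ p, (energy (B p) k (e p) - ∑ i, e p i ^ 2 +
        (2 * |α * g p| * √(∑ i, e p i ^ 2) + (α * g p) ^ 2) * (4 * N / (1 - ρ) - 1)) :=
        Finset.sum_le_sum fun p _ => (hB p).energy_step_le hN hρ0 hρ1
          (Real.sqrt_nonneg _) (hle p) _ k
    _ = ∑ p, energy (B p) k (e p) - ∑ p, ∑ i, e p i ^ 2 +
        (2 * α * (∑ p, |g p| * √(∑ i, e p i ^ 2)) + α ^ 2 * ∑ p, g p ^ 2) *
          (4 * N / (1 - ρ) - 1) := by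
        rw [Finset.sum_add_distrib, Finset.sum_sub_distrib, ← Finset.sum_mul,
          Finset.sum_add_distrib, Finset.mul_sum, Finset.mul_sum]
        simp only [abs_mul, abs_of_nonneg hα, mul_pow, mul_assoc]
    _ ≤ _ := by
        have : 0 ≤ 4 * (N : ℝ) / (1 - ρ) - 1 := by linarith
        gcongr

/-- One gradient step with inexact gradients. -/
lemma RegularGame.norm_step_sq_le (hJ : RegularGame J μ L) {α : ℝ} (hα : 0 ≤ α)
    {xs X g : Profile d} (hxs : pseudoGrad J xs = 0) {E : ℝ}
    (hg : ‖g - pseudoGrad J X‖ ≤ L * E) :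
    ‖X - α • g - xs‖ ^ 2 ≤ ‖X - xs‖ ^ 2 - 2 * α * μ * ‖X - xs‖ ^ 2 +
      2 * α * L * (‖X - xs‖ * E) + α ^ 2 * ‖g‖ ^ 2 := by
  have h1 : X - α • g - xs = (X - xs) - α • g := by abel
  rw [h1, norm_sub_sq_real, real_inner_smul_right, norm_smul, mul_pow, Real.norm_eq_abs, sq_abs]
  have h2 := hJ.stronglyMonotone X xs
  rw [hxs, sub_zero] at h2
  have h3 : inner ℝ (X - xs) g = inner ℝ (X - xs) (pseudoGrad J X) +
      inner ℝ (X - xs) (g - pseudoGrad J X) := by rw [← inner_add_right]; congr 1; abel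
  have h4 : -(‖X - xs‖ * (L * E)) ≤ inner ℝ (X - xs) (g - pseudoGrad J X) := by
    have := abs_real_inner_le_norm (X - xs) (g - pseudoGrad J X)
    have h5 := mul_le_mul_of_nonneg_left hg (norm_nonneg (X - xs))
    linarith [neg_abs_le (inner ℝ (X - xs) (g - pseudoGrad J X))]
  have h6 : α * (μ * ‖X - xs‖ ^ 2 - ‖X - xs‖ * (L * E)) ≤ α * inner ℝ (X - xs) g :=
    mul_le_mul_of_nonneg_left (by linarith) hα
  linarith

/-- The algebra of the Lyapunov descent: `δ` and `E` are the distances to the equilibrium and to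
agreement, `G` is the size of the gradient, `W` and `W'` are consecutive energies. -/
lemma descent_of_step {α μ L P δ δ' E G W W' : ℝ} (hα : 0 ≤ α) (hP : 1 ≤ P)
    (hE : 0 ≤ E) (hG : 0 ≤ G) (hGle : G ≤ L * (δ + E))
    (hst : δ' ^ 2 ≤ δ ^ 2 - 2 * α * μ * δ ^ 2 + 2 * α * L * (δ * E) + α ^ 2 * G ^ 2)
    (hen : W' ≤ W - E ^ 2 + (2 * α * (G * E) + α ^ 2 * G ^ 2) * (P - 1)) :
    δ' ^ 2 + W' ≤ δ ^ 2 + W - ((2 * α * μ - P * α ^ 2 * L ^ 2) * δ ^ 2 +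
      2 * (-(α * P * L * (1 + α * L))) * δ * E +
      (1 - 2 * α * (P - 1) * L - P * α ^ 2 * L ^ 2) * E ^ 2) := by
  have h1 : G ^ 2 ≤ (L * (δ + E)) ^ 2 := pow_le_pow_left₀ hG hGle 2
  -- The factor `P` of `α² G²` collects `P - 1` from the energies and `1` from the distance to the
  -- equilibrium.
  have h2 : P * α ^ 2 * G ^ 2 ≤ P * α ^ 2 * (L * (δ + E)) ^ 2 :=
    mul_le_mul_of_nonneg_left h1 (by positivity)
  have h3 : 2 * α * (P - 1) * E * G ≤ 2 * α * (P - 1) * E * (L * (δ + E)) := by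
    have : 0 ≤ P - 1 := by linarith
    gcongr
  linarith

/-- The Lyapunov function decreases by the quadratic form of the step-size condition. -/
lemma IsExecution.lyapunov_step (h : IsExecution J Gc Go A D η α x v y) (hN : 2 ≤ N)
    (hJ : RegularGame J μ L) (hself : ∀ i, Go.Adj i i) (hη : 0 < η) (hη1 : η ≤ 1) (hα : 0 ≤ α)
    {xs : Profile d} (hxs : pseudoGrad J xs = 0)
    {B : (m : Fin N) × Fin (d m) → ℕ → Matrix (Fin N) (Fin N) ℝ}
    (hB : ∀ p, SquareDecay (B p) (Real.rpow (contractionC N η) (2 / ((N : ℝ) - 1))))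
    (hrec : ∀ p k, k ≠ 0 → estError x v (k + 1) p =
        (B p (k + 1)).mulVec (estError x v k p + (α * usedGrad J v k p) • 1))
    {k : ℕ} (hk : k ≠ 0) :
    ‖played x (k + 1) - xs‖ ^ 2 + ∑ p, energy (B p) (k + 1) (estError x v (k + 1) p) ≤
      ‖played x k - xs‖ ^ 2 + ∑ p, energy (B p) k (estError x v k p) -
        ((2 * α * μ - pBar N η * α ^ 2 * (L : ℝ) ^ 2) * ‖played x k - xs‖ ^ 2 +
          2 * (-(α * pBar N η * L * (1 + α * L))) * ‖played x k - xs‖ *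
            √(∑ i, ‖v k i - played x k‖ ^ 2) +
          (1 - 2 * α * (pBar N η - 1) * L - pBar N η * α ^ 2 * (L : ℝ) ^ 2) *
            √(∑ i, ‖v k i - played x k‖ ^ 2) ^ 2) := by
  obtain ⟨hρ0, hρ1⟩ := rpow_contractionC_lt_one hN hη hη1
  have hP := one_le_pBar hN hη hη1
  have hen := sum_energy_step_le (α := α) (by omega) hρ0 hρ1 hB hP hα (estError x v k)
    (usedGrad J v k) k
  have hg := hJ.norm_usedGrad_sub_le (x := x) (v := v) k
  have hst := hJ.norm_step_sq_le hα hxs hg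
  have hE2 : √(∑ i, ‖v k i - played x k‖ ^ 2) ^ 2 = ∑ i, ‖v k i - played x k‖ ^ 2 :=
    Real.sq_sqrt (Finset.sum_nonneg fun i _ => sq_nonneg _)
  have hG2 : ∑ p, usedGrad J v k p ^ 2 = ‖usedGrad J v k‖ ^ 2 := by
    rw [EuclideanSpace.norm_sq_eq]; simp
  have hGle : ‖usedGrad J v k‖ ≤
      L * (‖played x k - xs‖ + √(∑ i, ‖v k i - played x k‖ ^ 2)) := by
    have h1 : ‖pseudoGrad J (played x k)‖ ≤ L * ‖played x k - xs‖ := by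
      simpa [dist_eq_norm, hxs] using hJ.lipschitz.dist_le_mul (played x k) xs
    have h2 := norm_le_norm_sub_add (usedGrad J v k) (pseudoGrad J (played x k))
    rw [mul_add]
    linarith
  rw [sum_estError_sq, hG2, Real.sqrt_sq (norm_nonneg _), ← hE2, hE2] at hen
  change _ ≤ _ - _ + _ * (pBar N η - 1) at hen
  rw [← hE2, Real.sqrt_sq (Real.sqrt_nonneg _)] at hen
  rw [h.played_succ hself hk, Finset.sum_congr rfl fun p _ => by rw [hrec p k hk]]
  exact descent_of_step hα hP (Real.sqrt_nonneg _) (norm_nonneg _) hGle hst hen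

lemma norm_setBlock_partialGrad_le (i : Fin N) (z : Profile d) :
    ‖(setBlock 0 i (partialGrad J i z) : Profile d)‖ ≤ ‖pseudoGrad J z‖ := by
  rw [EuclideanSpace.norm_eq, EuclideanSpace.norm_eq]
  refine Real.sqrt_le_sqrt (Finset.sum_le_sum fun p _ => ?_)
  obtain ⟨m, q⟩ := p
  by_cases hm : m = i
  · subst hm
    rw [setBlock_apply_same, pseudoGrad_apply]
  · rw [setBlock_apply_of_ne _ _ hm]
    simp [sq_nonneg]

/-- If the total error tends to zero, then all estimates converge. -/
lemma IsExecution.tendsto (h : IsExecution J Gc Go A D η α x v y) (hJ : RegularGame J μ L)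
    {xs : Profile d} (hxs : pseudoGrad J xs = 0)
    (hlim : Filter.Tendsto (fun k => ‖played x (k + 1) - xs‖ ^ 2 +
      √(∑ i, ‖v (k + 1) i - played x (k + 1)‖ ^ 2) ^ 2) Filter.atTop (nhds 0)) :
    Filter.Tendsto x Filter.atTop (nhds fun _ => xs) := by
  rw [tendsto_pi_nhds]
  intro i
  have hv : Filter.Tendsto (fun k => v (k + 1) i) Filter.atTop (nhds xs) := by
    rw [tendsto_iff_norm_sub_tendsto_zero]
    have h2 : Filter.Tendsto (fun k => √(2 * (‖played x (k + 1) - xs‖ ^ 2 +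
      √(∑ i, ‖v (k + 1) i - played x (k + 1)‖ ^ 2) ^ 2))) Filter.atTop (nhds 0) := by
      simpa using (hlim.const_mul 2).sqrt
    refine squeeze_zero (fun k => norm_nonneg _) (fun k => Real.le_sqrt_of_sq_le ?_) h2
    have h3 := norm_sub_le_norm_sub_add_norm_sub (v (k + 1) i) (played x (k + 1)) xs
    have h4 : ‖v (k + 1) i - played x (k + 1)‖ ^ 2 ≤
        ∑ i, ‖v (k + 1) i - played x (k + 1)‖ ^ 2 :=
      Finset.single_le_sum (f := fun i => ‖v (k + 1) i - played x (k + 1)‖ ^ 2)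
        (fun _ _ => sq_nonneg _) (Finset.mem_univ i)
    rw [Real.sq_sqrt (Finset.sum_nonneg fun _ _ => sq_nonneg _)]
    have h5 := pow_le_pow_left₀ (norm_nonneg _) h3 2
    nlinarith [sq_nonneg (‖v (k + 1) i - played x (k + 1)‖ - ‖played x (k + 1) - xs‖)]
  have hF : Filter.Tendsto (fun k => ‖pseudoGrad J (v (k + 1) i)‖) Filter.atTop (nhds 0) := by
    have := ((hJ.lipschitz.continuous.tendsto xs).comp hv).norm
    simpa [hxs] using this
  have hg : Filter.Tendsto (fun k => (setBlock 0 i (partialGrad J i (v (k + 1) i)) : Profile d))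
      Filter.atTop (nhds 0) :=
    squeeze_zero_norm (fun k => norm_setBlock_partialGrad_le i _) hF
  -- The errors are controlled from iteration `1` on, and `v (k + 1)` determines `x (k + 2)`.
  rw [← Filter.tendsto_add_atTop_iff_nat 2]
  have := hv.sub (hg.const_smul α)
  rw [smul_zero, sub_zero] at this
  exact this.congr fun k => (h.gradient_step (k + 1) i).symm

end Execution

/-- A nonnegative function that decreases by at least `r * s k` forces `s` to tend to zero. -/
lemma tendsto_zero_of_lyapunov {V s : ℕ → ℝ} {r : ℝ} (hr : 0 < r) (hV : ∀ k, 0 ≤ V k)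
    (hs : ∀ k, 0 ≤ s k) (hstep : ∀ k, V (k + 1) ≤ V k - r * s k) :
    Filter.Tendsto s Filter.atTop (nhds 0) := by
  have hsum : ∀ n, ∑ k ∈ Finset.range n, r * s k ≤ V 0 - V n := by
    intro n
    induction n with
    | zero => simp
    | succ n ih => rw [Finset.sum_range_succ]; linarith [hstep n]
  have h1 : Summable fun k => r * s k :=
    summable_of_sum_range_le (fun k => mul_nonneg hr.le (hs k))
      (fun n => (hsum n).trans (by linarith [hV n]) : ∀ n, _ ≤ V 0)
  simpa [hr.ne'] using h1.tendsto_atTop_zero.const_mul r⁻¹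

end RobustNE

theorem theorem1 {N : ℕ} (hN : 2 ≤ N) (d : Fin N → ℕ)
    (J : Fin N → RobustNE.Profile d → ℝ) (μ : ℝ) (L : NNReal)
    (hJ : RobustNE.RegularGame J μ L)
    (Gc Go : Digraph (Fin N)) (hself : ∀ i, Go.Adj i i)
    (A : Finset (Fin N)) (D : ℕ)
    (hlocal : RobustNE.IsLocalSet Gc D A)
    (hdeg : ∀ i ∉ A, 2 * D + 1 ≤ (RobustNE.inNbrs Gc i).card)
    (hrobust : ∀ m, RobustNE.InfoRobust Gc Go (2 * D + 1) m)
    (η : ℝ) (hη : 0 < η) (hη1 : η ≤ 1) (α : ℝ)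
    (hM : (RobustNE.matM μ (L : ℝ) (RobustNE.pBar N η) α).PosDef) :
    ∃ xs : RobustNE.Profile d, RobustNE.IsNash J xs ∧
      (∀ z, RobustNE.IsNash J z → z = xs) ∧
      ∀ (x v : ℕ → Fin N → RobustNE.Profile d)
        (y : ℕ → Fin N → Fin N → RobustNE.Profile d),
        RobustNE.IsExecution J Gc Go A D η α x v y →
        Filter.Tendsto x Filter.atTop (nhds (fun _ => xs)) := by
  open RobustNE in
  obtain ⟨r, hr, hquad⟩ := exists_pos_le_of_posDef hM
  have hP := one_le_pBar hN hη hη1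
  have hcond : pBar N η * α ^ 2 * (L : ℝ) ^ 2 < 2 * α * μ := by
    have := hquad 1 0
    norm_num at this
    linarith
  have hle : α ^ 2 * (L : ℝ) ^ 2 ≤ pBar N η * α ^ 2 * (L : ℝ) ^ 2 := by
    nlinarith [mul_nonneg (sq_nonneg α) (sq_nonneg (L : ℝ))]
  -- Positivity of the step size follows from the upper left entry of `M`: a nonnegative quantity
  -- lies strictly below `2 * α * μ`.
  have hα : 0 < α := by
    have h1 : 0 ≤ α ^ 2 * (L : ℝ) ^ 2 := by positivity
    have h2 := hJ.mu_pos
    by_contra hneg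
    nlinarith
  obtain ⟨xs, hxs⟩ := hJ.exists_pseudoGrad_eq_zero hα (hle.trans_lt hcond)
  refine ⟨xs, (hJ.isNash_iff xs).2 hxs, fun z hz =>
    hJ.eq_of_pseudoGrad_eq_zero ((hJ.isNash_iff z).1 hz) hxs, fun x v y hex => ?_⟩
  choose B hB hrec using hex.exists_recursion hN hself hlocal hrobust hη hη1
  refine hex.tendsto hJ hxs (tendsto_zero_of_lyapunov hr
    -- The index is shifted by one because the averaging rules bind only from iteration `1`; the
    -- initial `v 0` is arbitrary.
    (V := fun k => ‖played x (k + 1) - xs‖ ^ 2 +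
      ∑ p, energy (B p) (k + 1) (estError x v (k + 1) p)) (fun k => ?_) (fun k => ?_) fun k => ?_)
  · exact add_nonneg (sq_nonneg _) (Finset.sum_nonneg fun p _ => energy_nonneg _ _)
  · positivity
  · have h1 := hex.lyapunov_step hN hJ hself hη hη1 hα.le hxs hB hrec (Nat.succ_ne_zero k)
    have h2 := hquad ‖played x (k + 1) - xs‖ (√(∑ i, ‖v (k + 1) i - played x (k + 1)‖ ^ 2))
    exact h1.trans (sub_le_sub_left h2 _)
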